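/- Let $\mathcal N=\mathbb N^{\mathbb N}$ be Baire space, whose elements are called reals, and let $\le_T$ and $\equiv_T$ denote Turing reducibility and Turing equivalence on $\mathcal N$. Write $x\le_h d$ if $x$ is hyperarithmetic in $d$, i.e. $x\in\Delta^1_1(d)$. A set $A\subseteq\mathcal N$ is Turing closed if $x\in A$ and $x\equiv_T y$ imply $y\in A$; Turing closed sets are identified with sets of Turing degrees. The set $A$ is cofinal in the Turing degrees if for every $x\in\mathcal N$ there is $y\in A$ with $x\le_T y$. For $A\subseteq\mathcal N$, $G_\omega(A)$ is the infinite game in which players I and II alternately play natural numbers, producing $x\in\mathcal N$, and I wins if and only if $x\in A$. Assume Turing determinacy for the (lightface) $\Delta^1_1$ sets: for every Turing closed $\Delta^1_1$ set $A\subseteq\mathcal N$, one of the two players has a winning strategy in $G_\omega(A)$. Then every Turing closed (lightface) $\Sigma^1_1$ set $S\subseteq\mathcal N$ which is cofinal in the Turing degrees contains a hyp-Turing cone: there is $d_0\in\mathcal N$ such that $$\{x\in\mathcal N : d_0\le_T x \text{ and } x\le_h d_0\}\subseteq S.$$ -/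

import Mathlib

namespace EffDST

/-- Baire space: the set of reals. -/
abbrev Baire : Type := ℕ → ℕ

/-- The initial segment `⟨x 0, …, x (n - 1)⟩` of the real `x`. -/
def initSeg (x : Baire) (n : ℕ) : List ℕ := (List.range n).map x

/-- The basic open neighbourhood of Baire space determined by a finite sequence. -/
def nbhd (s : List ℕ) : Set Baire := {x | initSeg x s.length = s}

section Pointclasses

variable {α : Type} [Primcodable α]

/-- (Lightface) semirecursive subsets of `α × 𝒩 × 𝒩`, with `α` a discrete, effectively coded
factor: recursively enumerable unions of basic open sets `{a} × nbhd s × nbhd t`. -/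
def IsSigma01 (G : Set (α × Baire × Baire)) : Prop :=
  ∃ W : α × List ℕ × List ℕ → Prop, REPred W ∧
    ∀ a x y, (a, x, y) ∈ G ↔ ∃ s t, W (a, s, t) ∧ x ∈ nbhd s ∧ y ∈ nbhd t

/-- Lightface `Π⁰₁` subsets of `α × 𝒩 × 𝒩`. -/
def IsPi01 (F : Set (α × Baire × Baire)) : Prop := IsSigma01 Fᶜ

/-- Lightface `Σ¹₁` subsets of `α × 𝒩`: projections along `𝒩` of `Π⁰₁` sets. -/
def IsSigma11 (P : Set (α × Baire)) : Prop :=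
  ∃ F : Set (α × Baire × Baire), IsPi01 F ∧ ∀ a x, (a, x) ∈ P ↔ ∃ y, (a, x, y) ∈ F

/-- Lightface `Π¹₁` subsets of `α × 𝒩`. -/
def IsPi11 (P : Set (α × Baire)) : Prop := IsSigma11 Pᶜ

/-- Subsets of the discrete space `α` that are `Δ¹₁(d)`: both a `d`-section of a `Σ¹₁` set and a
`d`-section of a `Π¹₁` set. -/
def IsDelta11In (d : Baire) (R : Set α) : Prop :=
  (∃ P : Set (α × Baire), IsSigma11 P ∧ ∀ a, a ∈ R ↔ (a, d) ∈ P) ∧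
  (∃ Q : Set (α × Baire), IsPi11 Q ∧ ∀ a, a ∈ R ↔ (a, d) ∈ Q)

end Pointclasses

/-- Lightface `Σ¹₁` sets of reals (`𝒩` is identified with `Unit × 𝒩`). -/
def IsSigma11Set (A : Set Baire) : Prop := IsSigma11 {p : Unit × Baire | p.2 ∈ A}

/-- Lightface `Π¹₁` sets of reals. -/
def IsPi11Set (A : Set Baire) : Prop := IsPi11 {p : Unit × Baire | p.2 ∈ A}

/-- Lightface `Δ¹₁` sets of reals. -/
def IsDelta11Set (A : Set Baire) : Prop := IsSigma11Set A ∧ IsPi11Set A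

/-- Turing reducibility of reals (total functions `ℕ → ℕ`). -/
def TuringLE (x y : Baire) : Prop := TuringReducible (x : ℕ →. ℕ) (y : ℕ →. ℕ)

/-- Turing equivalence of reals. -/
def TuringEquiv (x y : Baire) : Prop := TuringLE x y ∧ TuringLE y x

/-- Hyperarithmetic reducibility of reals: `x` (that is, its graph) is `Δ¹₁(y)`. -/
def HypLE (x y : Baire) : Prop := IsDelta11In y {p : ℕ × ℕ | x p.1 = p.2}

/-- Turing closed sets of reals; these are identified with the sets of Turing degrees. -/
def TuringClosed (A : Set Baire) : Prop := ∀ x y, TuringEquiv x y → x ∈ A → y ∈ A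

/-- Sets of reals that are cofinal in the Turing degrees. -/
def TuringCofinal (A : Set Baire) : Prop := ∀ x, ∃ y ∈ A, TuringLE x y

/-- The hyp-Turing cone with vertex `d` (as a set of reals). -/
def hypTuringCone (d : Baire) : Set Baire := {x | TuringLE d x ∧ HypLE x d}

/-- A strategy assigns a move to each finite position. In a play `x`, player I chooses the moves
`x 0, x 2, …` and player II the moves `x 1, x 3, …`. -/
abbrev Strategy : Type := List ℕ → ℕ

/-- In the play `x`, player I follows `σ`. -/
def FollowsI (σ : Strategy) (x : Baire) : Prop := ∀ n, x (2 * n) = σ (initSeg x (2 * n))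

/-- In the play `x`, player II follows `τ`. -/
def FollowsII (τ : Strategy) (x : Baire) : Prop :=
  ∀ n, x (2 * n + 1) = τ (initSeg x (2 * n + 1))

/-- The infinite game with payoff set `A` (player I wins the play `x` iff `x ∈ A`) is
determined: one of the players has a winning strategy. -/
def Determined (A : Set Baire) : Prop :=
  (∃ σ : Strategy, ∀ x, FollowsI σ x → x ∈ A) ∨ (∃ τ : Strategy, ∀ x, FollowsII τ x → x ∉ A)

/-- Turing determinacy for the class `Γ`. -/
def TuringDet (Γ : Set Baire → Prop) : Prop := ∀ A, Γ A → TuringClosed A → Determined A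

/-- Hyp-Turing determinacy for the class `Γ`: every cofinal set of Turing degrees in `Γ` contains
a hyp-Turing cone. -/
def HypTuringDet (Γ : Set Baire → Prop) : Prop :=
  ∀ A, Γ A → TuringClosed A → TuringCofinal A → ∃ d, hypTuringCone d ⊆ A

end EffDST

namespace EffDST

open Encodable Filter

/-! Suppose the Σ¹₁ set S is Turing closed and cofinal but contains no hyp-Turing cone. Then every d
has some x outside S with d ≤_T x and x ≤_h d. If such x can be collected into a Σ¹₁ set C that is
cofinal and disjoint from S, effective Suslin separation puts a Δ¹₁ set B between C and the
complement of S. The Turing saturation of B is still Δ¹₁, because quantifying over reals computable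
from x is quantifying over programs, and it misses S because S is Turing closed. Determinacy of its
game is then contradictory. A winning strategy σ for I, played against some y ∈ S that computes σ,
gives a play of the degree of y, so the saturation meets S. A winning strategy for II, played
against some y ∈ C that computes it, loses in the same way.

Both the set C and the separation come from `exists_selector`. A Π¹₁ predicate V(γ, a) says that a
tree T(γ, a) is well founded. Its selector chooses the first index whose tree has least rank, with
ill-founded trees of rank ∞. Ranks are compared by simulations (`Sim`), whose existence is Σ¹₁, so
the selector is Σ¹₁ and nonempty at every γ, and it is a uniformization of V wherever V has a
solution. In `exists_sig_cofinal` it is used twice: to decode a Π¹₁ index of the graph of a real,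
and to choose an index whose real is a counterexample above d. -/

section InitSeg

/-! ### Finite initial segments of reals. -/

@[simp] theorem length_initSeg (x : Baire) (n : ℕ) : (initSeg x n).length = n := by
  simp [initSeg]

theorem take_initSeg (x : Baire) (n m : ℕ) : (initSeg x n).take m = initSeg x (min m n) := by
  simp [initSeg, ← List.map_take, List.take_range]

theorem getElem?_initSeg (x : Baire) {n i : ℕ} (h : i < n) : (initSeg x n)[i]? = some (x i) := by
  simp [initSeg, h]

theorem getElem?_initSeg_of_le (x : Baire) {n i : ℕ} (h : n ≤ i) : (initSeg x n)[i]? = none := by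
  simp [initSeg, h]

theorem initSeg_succ (x : Baire) (n : ℕ) : initSeg x (n + 1) = initSeg x n ++ [x n] := by
  simp [initSeg, List.range_succ]

theorem initSeg_zero (x : Baire) : initSeg x 0 = [] := rfl

theorem map_initSeg (x : Baire) (n : ℕ) (h : ℕ → ℕ) :
    (initSeg x n).map h = initSeg (fun i => h (x i)) n := by
  simp [initSeg, Function.comp_def]

theorem headI_initSeg (x : Baire) {n : ℕ} (h : n ≠ 0) : (initSeg x n).headI = x 0 := by
  obtain ⟨n, rfl⟩ := Nat.exists_eq_succ_of_ne_zero h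
  simp [initSeg, List.range_succ_eq_map]

theorem initSeg_congr {x y : Baire} {n : ℕ} (h : ∀ i < n, x i = y i) :
    initSeg x n = initSeg y n := by
  simp only [initSeg]
  exact List.map_congr_left fun i hi => h i (List.mem_range.1 hi)

theorem initSeg_eq_iff {x y : Baire} {n : ℕ} :
    initSeg x n = initSeg y n ↔ ∀ i < n, x i = y i := by
  refine ⟨fun h i hi => ?_, initSeg_congr⟩
  have := congrArg (fun l => l[i]?) h
  simpa [getElem?_initSeg _ hi] using this

end InitSeg

/-! ### Coded contexts and effective maps between them. -/

/-- Types whose elements are coded by reals; pairs are coded pointwise. -/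
class Ctx (Γ : Type) where
  /-- The real coding an element. -/
  code : Γ → Baire

open Ctx

instance : Ctx ℕ := ⟨fun k _ => k⟩
instance : Ctx (List ℕ) := ⟨fun l _ => encode l⟩
instance : Ctx Baire := ⟨id⟩
instance {Γ Δ : Type} [Ctx Γ] [Ctx Δ] : Ctx (Γ × Δ) :=
  ⟨fun p n => Nat.pair (code p.1 n) (code p.2 n)⟩

/-- Discrete contexts: the code of `a` is constant with value `encode a`. -/
class Disc (α : Type) [Primcodable α] [Ctx α] : Prop where
  code_eq : ∀ (a : α) (n : ℕ), code a n = encode a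

instance : Disc ℕ := ⟨fun _ _ => rfl⟩
instance : Disc (List ℕ) := ⟨fun _ _ => rfl⟩
instance {α β : Type} [Primcodable α] [Ctx α] [Disc α] [Primcodable β] [Ctx β] [Disc β] :
    Disc (α × β) :=
  ⟨fun p n => by
    change Nat.pair (code p.1 n) (code p.2 n) = Nat.pair (encode p.1) (encode p.2)
    rw [Disc.code_eq, Disc.code_eq]⟩

variable {Γ Δ Θ : Type} [Ctx Γ] [Ctx Δ] [Ctx Θ]
variable {α β : Type} [Primcodable α] [Ctx α] [Disc α] [Primcodable β] [Ctx β] [Disc β]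

/-- Maps induced on codes by a primitive recursive map of finite initial segments. -/
def CompMap (f : Γ → Δ) : Prop :=
  ∃ g : List ℕ → List ℕ, Primrec g ∧ ∀ γ, ∃ ℓ : ℕ → ℕ, Tendsto ℓ atTop atTop ∧
    ∀ n, g (initSeg (code γ) n) = initSeg (code (f γ)) (ℓ n)

namespace CompMap

theorem comp {f : Δ → Θ} {h : Γ → Δ} (hf : CompMap f) (hh : CompMap h) :
    CompMap fun γ => f (h γ) := by
  obtain ⟨g, hg, Hg⟩ := hf
  obtain ⟨k, hk, Hk⟩ := hh
  refine ⟨fun s => g (k s), hg.comp hk, fun γ => ?_⟩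
  obtain ⟨ℓ, hℓ, H⟩ := Hk γ
  obtain ⟨ℓ', hℓ', H'⟩ := Hg (h γ)
  exact ⟨fun n => ℓ' (ℓ n), hℓ'.comp hℓ, fun n => by simp only [H, H']⟩

theorem pointwise {f : Γ → Δ} {h : ℕ → ℕ} (hh : Primrec h)
    (H : ∀ γ n, code (f γ) n = h (code γ n)) : CompMap f := by
  refine ⟨List.map h, Primrec.list_map Primrec.id (hh.comp Primrec.snd), fun γ =>
    ⟨id, tendsto_id, fun n => ?_⟩⟩
  rw [map_initSeg]
  exact initSeg_congr fun i _ => (H γ i).symm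

theorem id : CompMap (fun γ : Γ => γ) := pointwise Primrec.id fun _ _ => rfl

theorem fst : CompMap (Prod.fst : Γ × Δ → Γ) :=
  pointwise (Primrec.fst.comp Primrec.unpair) fun γ n => by
    change _ = (Nat.unpair (Nat.pair _ _)).1
    rw [Nat.unpair_pair]

theorem snd : CompMap (Prod.snd : Γ × Δ → Δ) :=
  pointwise (Primrec.snd.comp Primrec.unpair) fun γ n => by
    change _ = (Nat.unpair (Nat.pair _ _)).2
    rw [Nat.unpair_pair]

theorem codeReal : CompMap (fun γ : Γ => code γ) := pointwise Primrec.id fun _ _ => rfl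

theorem real_fst : CompMap (fun (y : Baire) n => (Nat.unpair (y n)).1) :=
  pointwise (Primrec.fst.comp Primrec.unpair) fun _ _ => rfl

theorem real_snd : CompMap (fun (y : Baire) n => (Nat.unpair (y n)).2) :=
  pointwise (Primrec.snd.comp Primrec.unpair) fun _ _ => rfl

theorem prim {f : α → β} (hf : Primrec f) : CompMap f := by
  refine pointwise (h := fun c => ((decode (α := α) c).map fun a => encode (f a)).getD 0) ?_ ?_
  · exact Primrec.option_getD.comp
      (Primrec.option_map Primrec.decode
        ((Primrec.encode.comp (hf.comp Primrec.snd)).to₂)) (Primrec.const 0)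
  · intro a n
    simp [Disc.code_eq]

theorem const (b : β) : CompMap (fun _ : Γ => b) :=
  pointwise (Primrec.const (encode b)) fun _ n => Disc.code_eq b n

theorem pair {f : Γ → Δ} {h : Γ → Θ} (hf : CompMap f) (hh : CompMap h) :
    CompMap fun γ => (f γ, h γ) := by
  obtain ⟨g, hg, Hg⟩ := hf
  obtain ⟨k, hk, Hk⟩ := hh
  refine ⟨fun s => (List.range (min (g s).length (k s).length)).map fun i =>
    Nat.pair ((g s).getD i 0) ((k s).getD i 0), ?_, fun γ => ?_⟩
  · refine Primrec.list_map (Primrec.list_range.comp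
      (Primrec.nat_min.comp (Primrec.list_length.comp hg) (Primrec.list_length.comp hk))) ?_
    exact Primrec₂.natPair.comp
      ((Primrec.list_getD 0).comp (hg.comp Primrec.fst) Primrec.snd)
      ((Primrec.list_getD 0).comp (hk.comp Primrec.fst) Primrec.snd)
  · obtain ⟨ℓ, hℓ, H⟩ := Hg γ
    obtain ⟨ℓ', hℓ', H'⟩ := Hk γ
    refine ⟨fun n => min (ℓ n) (ℓ' n), tendsto_atTop.2 fun b => ?_, fun n => ?_⟩
    · filter_upwards [hℓ.eventually_ge_atTop b, hℓ'.eventually_ge_atTop b] with n h1 h2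
      exact le_min h1 h2
    · simp only [H, H', length_initSeg]
      conv_rhs => rw [initSeg]
      refine List.map_congr_left fun i hi => ?_
      have hi := List.mem_range.1 hi
      rw [lt_min_iff] at hi
      simp only [List.getD_eq_getElem?_getD, getElem?_initSeg _ hi.1, getElem?_initSeg _ hi.2]
      rfl

theorem prim₂ {γ : Type} [Primcodable γ] [Ctx γ] [Disc γ] {F : α → β → γ} (hF : Primrec₂ F)
    {f : Γ → α} {h : Γ → β} (hf : CompMap f) (hh : CompMap h) :
    CompMap fun x => F (f x) (h x) :=
  (prim (f := fun p : α × β => F p.1 p.2) hF).comp (hf.pair hh)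

/-- A map with constant codes is effective once its value can be read off all long enough segments
of the input; shorter segments may output the empty list, since output lengths need only tend to
infinity. -/
theorem of_tail {f : Γ → Δ} {v : List ℕ → Option ℕ} (hv : Primrec v)
    (hconst : ∀ γ n, code (f γ) n = code (f γ) 0)
    (h1 : ∀ (γ : Γ) n c, v (initSeg (code γ) n) = some c → c = code (f γ) 0)
    (h2 : ∀ γ : Γ, ∃ N, ∀ n ≥ N, (v (initSeg (code γ) n)).isSome) : CompMap f := by
  refine ⟨fun s => (v s).toList.flatMap fun c => s.map fun _ => c, ?_, fun γ => ?_⟩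
  · refine Primrec.list_flatMap (Primrec.optionToList.comp hv) ?_
    exact (Primrec.list_map Primrec.fst (Primrec.snd.comp Primrec.fst).to₂).to₂
  · obtain ⟨N, hN⟩ := h2 γ
    refine ⟨fun n => if (v (initSeg (code γ) n)).isSome then n else 0, ?_, fun n => ?_⟩
    · refine tendsto_atTop.2 fun b => ?_
      filter_upwards [eventually_ge_atTop (max N b)] with n hn
      rw [if_pos (hN n (le_trans (le_max_left _ _) hn))]
      exact le_trans (le_max_right _ _) hn
    · simp only
      cases hc : v (initSeg (code γ) n) with
      | none => simp [initSeg_zero]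
      | some c =>
        have := h1 γ n c hc
        simp only [Option.toList_some, List.flatMap_cons, List.flatMap_nil, List.append_nil,
          Option.isSome_some, if_true, map_initSeg]
        exact initSeg_congr fun i _ => by rw [hconst, this]

theorem app : CompMap (fun p : Baire × ℕ => p.1 p.2) := by
  -- Every entry of the code of `(x, k)` carries `k`, so the head of the segment already tells which
  -- entry to look up.
  refine of_tail (v := fun s => (s[(Nat.unpair s.headI).2]?).map fun c => (Nat.unpair c).1)
    ?_ (fun _ _ => rfl) ?_ ?_
  · exact Primrec.option_map (Primrec.list_getElem?.comp Primrec.id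
      (Primrec.snd.comp (Primrec.unpair.comp Primrec.list_headI)))
      (Primrec.fst.comp (Primrec.unpair.comp Primrec.snd)).to₂
  · rintro ⟨x, k⟩ n c h
    rcases Nat.eq_zero_or_pos n with rfl | hn
    · simp [initSeg_zero] at h
    rw [headI_initSeg _ hn.ne'] at h
    change Option.map _ (initSeg _ n)[(Nat.unpair (Nat.pair (x 0) k)).2]? = some c at h
    rw [Nat.unpair_pair] at h
    rcases lt_or_ge k n with hk | hk
    · rw [getElem?_initSeg _ hk] at h
      change some (Nat.unpair (Nat.pair (x k) k)).1 = some c at h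
      rw [Nat.unpair_pair] at h
      exact (Option.some.inj h).symm
    · rw [getElem?_initSeg_of_le _ hk] at h
      cases h
  · rintro ⟨x, k⟩
    refine ⟨k + 1, fun n hn => ?_⟩
    rw [headI_initSeg _ (by omega)]
    change (Option.map _ (initSeg _ n)[(Nat.unpair (Nat.pair (x 0) k)).2]?).isSome
    rw [Nat.unpair_pair, getElem?_initSeg _ (by simp; omega)]
    rfl

theorem map_unpair_code (x : Baire) (k n : ℕ) :
    (initSeg (code (x, k)) n).map (fun c => (Nat.unpair c).1) = initSeg x n := by
  rw [map_initSeg]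
  refine initSeg_congr fun i _ => ?_
  change (Nat.unpair (Nat.pair (x i) k)).1 = x i
  rw [Nat.unpair_pair]

theorem headI_code (x : Baire) (k : ℕ) {n : ℕ} (hn : n ≠ 0) :
    (Nat.unpair (initSeg (code (x, k)) n).headI).2 = k := by
  rw [headI_initSeg _ hn]
  change (Nat.unpair (Nat.pair (x 0) k)).2 = k
  rw [Nat.unpair_pair]

theorem initSeg : CompMap (fun p : Baire × ℕ => EffDST.initSeg p.1 p.2) := by
  refine of_tail (v := fun s => if 1 ≤ s.length ∧ (Nat.unpair s.headI).2 ≤ s.length then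
    some (encode ((s.map fun c => (Nat.unpair c).1).take (Nat.unpair s.headI).2)) else none)
    ?_ (fun _ _ => rfl) ?_ ?_
  · have hk : Primrec fun s : List ℕ => (Nat.unpair s.headI).2 :=
      Primrec.snd.comp (Primrec.unpair.comp Primrec.list_headI)
    refine Primrec.ite ((Primrec.nat_le.comp (Primrec.const 1) Primrec.list_length).and
      (Primrec.nat_le.comp hk Primrec.list_length)) ?_ (Primrec.const none)
    exact Primrec.option_some.comp (Primrec.encode.comp (Primrec.list_take.comp hk
      (Primrec.list_map Primrec.id (Primrec.fst.comp (Primrec.unpair.comp Primrec.snd)).to₂)))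
  · rintro ⟨x, k⟩ n c h
    rcases Nat.eq_zero_or_pos n with rfl | hn
    · simp [initSeg_zero] at h
    simp only [headI_code _ _ hn.ne', map_unpair_code, length_initSeg, take_initSeg] at h
    split_ifs at h with hh
    rw [min_eq_left hh.2] at h
    exact (Option.some.inj h).symm
  · rintro ⟨x, k⟩
    refine ⟨k + 1, fun n hn => ?_⟩
    simp only [headI_code _ _ (show n ≠ 0 by omega), length_initSeg]
    rw [if_pos ⟨by omega, by omega⟩]
    rfl

/-- The map sending `(y, k)` to the `k`-th column of `y`. -/
theorem col : CompMap (fun (p : Baire × ℕ) n => p.1 (Nat.pair p.2 n)) := by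
  -- If `k + i < √m` then `Nat.pair k i < (max k i + 1)² ≤ m`, so these entries of the column are
  -- visible in a segment of length `m`.
  refine ⟨fun s => (List.range (Nat.sqrt s.length - (Nat.unpair s.headI).2)).map fun n =>
    (s.map fun c => (Nat.unpair c).1).getD (Nat.pair (Nat.unpair s.headI).2 n) 0, ?_, ?_⟩
  · have hk : Primrec fun s : List ℕ => (Nat.unpair s.headI).2 :=
      Primrec.snd.comp (Primrec.unpair.comp Primrec.list_headI)
    refine Primrec.list_map (Primrec.list_range.comp (Primrec.nat_sub.comp
      (Primrec.nat_sqrt.comp Primrec.list_length) hk)) ?_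
    exact ((Primrec.list_getD 0).comp
      (Primrec.list_map Primrec.fst (Primrec.fst.comp (Primrec.unpair.comp Primrec.snd)).to₂)
      (Primrec₂.natPair.comp (hk.comp Primrec.fst) Primrec.snd)).to₂
  · rintro ⟨x, k⟩
    refine ⟨fun m => Nat.sqrt m - k, ?_, fun m => ?_⟩
    · refine tendsto_atTop.2 fun b => ?_
      filter_upwards [eventually_ge_atTop ((b + k) * (b + k))] with n hn
      have := Nat.le_sqrt.2 hn
      omega
    · rcases Nat.eq_zero_or_pos m with rfl | hm
      · simp [initSeg_zero]
      simp only [headI_code _ _ hm.ne', map_unpair_code, length_initSeg]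
      conv_rhs => rw [EffDST.initSeg]
      refine List.map_congr_left fun i hi => ?_
      have hi := List.mem_range.1 hi
      have h1 : Nat.pair k i < m := by
        have h2 := Nat.pair_lt_max_add_one_sq k i
        have h3 : max k i + 1 ≤ Nat.sqrt m := by
          rcases max_cases k i with h | h <;> omega
        have h4 := Nat.sqrt_le m
        exact h2.trans_le (le_trans (by rw [pow_two]; exact Nat.mul_le_mul h3 h3) h4)
      rw [List.getD_eq_getElem?_getD, getElem?_initSeg _ h1]
      rfl

end CompMap

/-! ### Closure properties of Π⁰₁ and Σ⁰₁. -/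

/-- Lightface `Π⁰₁` predicates on a context. -/
def Pi (P : Γ → Prop) : Prop :=
  ∃ R : List ℕ → Prop, PrimrecPred R ∧ ∀ γ, P γ ↔ ∀ n, R (initSeg (code γ) n)

/-- Lightface `Σ⁰₁` predicates on a context. -/
def Sg (P : Γ → Prop) : Prop := Pi fun γ => ¬ P γ

theorem PrimrecRel.exists_lt' {α : Type*} [Primcodable α] {R : ℕ → α → Prop}
    (hR : PrimrecRel R) : PrimrecRel fun n y => ∃ x < n, R x y :=
  (hR.exists_mem_list.comp (Primrec.list_range.comp Primrec.fst) Primrec.snd).of_eq (by simp)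

theorem PrimrecRel.forall_lt' {α : Type*} [Primcodable α] {R : ℕ → α → Prop}
    (hR : PrimrecRel R) : PrimrecRel fun n y => ∀ x < n, R x y :=
  (hR.forall_mem_list.comp (Primrec.list_range.comp Primrec.fst) Primrec.snd).of_eq (by simp)

theorem PrimrecPred.forall_take {R : List ℕ → Prop} (hR : PrimrecPred R) :
    PrimrecPred fun s : List ℕ => ∀ j < s.length + 1, R (s.take j) := by
  have h : PrimrecRel fun (j : ℕ) (s : List ℕ) => R (s.take j) :=
    hR.comp (Primrec.list_take.comp Primrec.fst Primrec.snd)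
  have h' := PrimrecRel.forall_lt' h
  exact h'.comp (Primrec.succ.comp Primrec.list_length) Primrec.id

namespace Pi

theorem of_iff {P Q : Γ → Prop} (hP : Pi P) (h : ∀ γ, Q γ ↔ P γ) : Pi Q := by
  have : Q = P := funext fun γ => propext (h γ)
  rwa [this]

/-- Requiring `R` of all shorter segments as well turns it into a tree. Arbitrarily long segments
then suffice as tests, which is what composition with maps that skip lengths needs. -/
theorem exists_closed {P : Γ → Prop} (hP : Pi P) :
    ∃ R : List ℕ → Prop, PrimrecPred R ∧ (∀ s j, R s → R (s.take j)) ∧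
      ∀ γ, P γ ↔ ∀ n, R (initSeg (code γ) n) := by
  obtain ⟨R, hR, H⟩ := hP
  refine ⟨fun s => ∀ j < s.length + 1, R (s.take j), PrimrecPred.forall_take hR,
    fun s j h i hi => ?_, fun γ => ?_⟩
  · rw [List.take_take]
    refine h _ ?_
    rw [List.length_take] at hi
    omega
  · rw [H]
    constructor
    · intro h n j hj
      rw [take_initSeg]
      exact h _
    · intro h n
      have := h n n (by simp)
      rwa [take_initSeg, min_self] at this

theorem closed_of_frequently {R : List ℕ → Prop} (hR : ∀ s j, R s → R (s.take j)) {x : Baire}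
    {n m : ℕ} (hnm : n ≤ m) (h : R (EffDST.initSeg x m)) : R (EffDST.initSeg x n) := by
  have := hR _ n h
  rwa [take_initSeg, min_eq_left hnm] at this

theorem comp {P : Δ → Prop} (hP : Pi P) {f : Γ → Δ} (hf : CompMap f) : Pi fun γ => P (f γ) := by
  obtain ⟨R, hR, hcl, H⟩ := hP.exists_closed
  obtain ⟨g, hg, Hg⟩ := hf
  refine ⟨fun s => R (g s), hR.comp hg, fun γ => ?_⟩
  obtain ⟨ℓ, hℓ, Hℓ⟩ := Hg γ
  simp only [H, Hℓ]
  refine ⟨fun h n => h _, fun h n => ?_⟩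
  obtain ⟨m, hm⟩ := (hℓ.eventually_ge_atTop n).exists
  exact closed_of_frequently hcl hm (h m)

theorem and {P Q : Γ → Prop} (hP : Pi P) (hQ : Pi Q) : Pi fun γ => P γ ∧ Q γ := by
  obtain ⟨R, hR, H⟩ := hP
  obtain ⟨R', hR', H'⟩ := hQ
  exact ⟨fun s => R s ∧ R' s, hR.and hR', fun γ => by simp only [H, H', forall_and]⟩

theorem or {P Q : Γ → Prop} (hP : Pi P) (hQ : Pi Q) : Pi fun γ => P γ ∨ Q γ := by
  obtain ⟨R, hR, hc, H⟩ := hP.exists_closed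
  obtain ⟨R', hR', hc', H'⟩ := hQ.exists_closed
  refine ⟨fun s => R s ∨ R' s, hR.or hR', fun γ => ?_⟩
  simp only [H, H']
  constructor
  · rintro (h | h) n
    exacts [Or.inl (h n), Or.inr (h n)]
  · intro h
    by_contra! hn
    obtain ⟨⟨n, hn⟩, m, hm⟩ := hn
    rcases h (max n m) with h | h
    · exact hn (closed_of_frequently hc (le_max_left _ _) h)
    · exact hm (closed_of_frequently hc' (le_max_right _ _) h)

theorem initSeg_code_pair (γ : Γ) (k n : ℕ) :
    EffDST.initSeg (code (γ, k)) n = (EffDST.initSeg (code γ) n).map fun c => Nat.pair c k := by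
  rw [map_initSeg]
  rfl

theorem primrec_map_pair : Primrec₂ fun (k : ℕ) (s : List ℕ) => s.map fun c => Nat.pair c k :=
  (Primrec.list_map Primrec.snd
    (Primrec₂.natPair.comp Primrec.snd (Primrec.fst.comp Primrec.fst)).to₂).to₂

/-- Dovetailing: a segment of length `n` is tested for all `k < n`, and the tree property recovers
the tests with `k ≥ n` from longer segments. -/
theorem all {P : Γ → ℕ → Prop} (hP : Pi fun p : Γ × ℕ => P p.1 p.2) :
    Pi fun γ => ∀ k, P γ k := by
  obtain ⟨R, hR, hc, H⟩ := hP.exists_closed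
  refine ⟨fun s => ∀ k < s.length, R (s.map fun c => Nat.pair c k), ?_, fun γ => ?_⟩
  · have h : PrimrecRel fun (k : ℕ) (s : List ℕ) => R (s.map fun c => Nat.pair c k) :=
      hR.comp primrec_map_pair
    have h' := PrimrecRel.forall_lt' h
    exact h'.comp Primrec.list_length Primrec.id
  · constructor
    · intro h n k _
      have := (H (γ, k)).1 (h k) n
      rwa [initSeg_code_pair] at this
    · intro h k
      refine (H (γ, k)).2 fun n => ?_
      have := h (max n (k + 1)) k (by simp)
      rw [← initSeg_code_pair] at this
      exact closed_of_frequently hc (le_max_left _ _) this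

theorem all_list {P : Γ → List ℕ → Prop} (hP : Pi fun p : Γ × List ℕ => P p.1 p.2) :
    Pi fun γ => ∀ l, P γ l := by
  have h : Pi fun p : Γ × ℕ => P p.1 (Denumerable.ofNat (List ℕ) p.2) :=
    hP.comp (f := fun p : Γ × ℕ => (p.1, Denumerable.ofNat (List ℕ) p.2))
      (CompMap.fst.pair ((CompMap.prim (Primrec.ofNat (List ℕ))).comp CompMap.snd))
  refine (all (P := fun γ k => P γ (Denumerable.ofNat (List ℕ) k)) h).of_iff fun γ =>
    ⟨fun h k => h _, fun h l => ?_⟩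
  have := h (encode l)
  rwa [Denumerable.ofNat_encode] at this

theorem prim {p : α → Prop} (hp : PrimrecPred p) {f : Γ → α} (hf : CompMap f) :
    Pi fun γ => p (f γ) := by
  refine comp (P := p) ?_ hf
  obtain ⟨hd, hp⟩ := hp
  -- The first entry of the code is already `encode a`; the empty segment carries no information and
  -- must pass.
  refine ⟨fun s => (((s.head?).bind fun c => (decode c : Option α)).map
    fun a => decide (p a)).getD true = true, ?_, fun a => ?_⟩
  · refine Primrec.eq.comp (Primrec.option_getD.comp (Primrec.option_map
      (Primrec.option_bind Primrec.list_head? (Primrec.decode.comp Primrec.snd).to₂)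
      (hp.comp Primrec.snd).to₂) (Primrec.const true)) (Primrec.const true)
  · have key : ∀ n, n ≠ 0 → (EffDST.initSeg (code a) n).head? = some (encode a) := by
      intro n hn
      rw [List.head?_eq_getElem?, getElem?_initSeg _ (Nat.pos_of_ne_zero hn), Disc.code_eq]
    constructor
    · intro h n
      rcases eq_or_ne n 0 with rfl | hn
      · simp [initSeg_zero]
      · simp [key n hn, h]
    · intro h
      simpa [key 1 one_ne_zero] using h 1

/-- A finite disjunction of closed conditions is closed: if each `k` below the bound fails at some
length, all of them fail at any length beyond the maximum. -/
theorem bex {P : Γ → ℕ → Prop} (hP : Pi fun p : Γ × ℕ => P p.1 p.2) {b : Γ → ℕ}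
    (hb : CompMap b) : Pi fun γ => ∃ k < b γ, P γ k := by
  suffices h : Pi fun p : Γ × ℕ => ∃ k < p.2, P p.1 k from
    h.comp (f := fun γ => (γ, b γ)) (CompMap.id.pair hb)
  obtain ⟨R, hR, hc, H⟩ := hP.exists_closed
  have hm : Primrec fun s : List ℕ => (Nat.unpair s.headI).2 :=
    Primrec.snd.comp (Primrec.unpair.comp Primrec.list_headI)
  have hfst : Primrec fun s : List ℕ => s.map fun c => (Nat.unpair c).1 :=
    Primrec.list_map Primrec.id (Primrec.fst.comp (Primrec.unpair.comp Primrec.snd)).to₂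
  -- The bound is read from the head, so the empty segment has to be let through separately.
  refine ⟨fun s => s.length = 0 ∨ ∃ k < (Nat.unpair s.headI).2,
    R ((s.map fun c => (Nat.unpair c).1).map fun c => Nat.pair c k), ?_, ?_⟩
  · refine (Primrec.eq.comp Primrec.list_length (Primrec.const 0)).or ?_
    have h : PrimrecRel fun (k : ℕ) (s : List ℕ) =>
        R ((s.map fun c => (Nat.unpair c).1).map fun c => Nat.pair c k) :=
      hR.comp (primrec_map_pair.comp Primrec.fst (hfst.comp Primrec.snd))
    have h' := PrimrecRel.exists_lt' h
    exact h'.comp hm Primrec.id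
  · rintro ⟨γ, m⟩
    have hs : ∀ n k, ((EffDST.initSeg (code (γ, m)) n).map fun c => (Nat.unpair c).1).map
        (fun c => Nat.pair c k) = EffDST.initSeg (code (γ, k)) n := by
      intro n k
      rw [initSeg_code_pair, initSeg_code_pair, List.map_map]
      simp [Function.comp_def]
    have hm' : ∀ n, n ≠ 0 → (Nat.unpair (EffDST.initSeg (code (γ, m)) n).headI).2 = m := by
      intro n hn
      rw [headI_initSeg _ hn]
      change (Nat.unpair (Nat.pair _ m)).2 = m
      rw [Nat.unpair_pair]
    simp only [hs, length_initSeg]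
    constructor
    · rintro ⟨k, hk, h⟩ n
      rcases eq_or_ne n 0 with rfl | hn
      · exact Or.inl rfl
      · refine Or.inr ⟨k, ?_, (H (γ, k)).1 h n⟩
        rwa [hm' n hn]
    · intro h
      by_contra! hcon
      have hcon' : ∀ k, ∃ n, k < m → ¬ R (EffDST.initSeg (code (γ, k)) n) := by
        intro k
        by_cases hk : k < m
        · have := hcon k hk
          rw [H (γ, k)] at this
          push Not at this
          exact this.imp fun n hn _ => hn
        · exact ⟨0, fun h => absurd h hk⟩
      choose N hN using hcon'
      obtain ⟨B, hB⟩ : ∃ B, ∀ k < m, N k ≤ B :=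
        ⟨(Finset.range m).sup N, fun k hk => Finset.le_sup (Finset.mem_range.2 hk)⟩
      rcases h (B + 1) with h | ⟨k, hk, h⟩
      · omega
      · rw [hm' _ (by omega)] at hk
        exact hN k hk (closed_of_frequently hc (by have := hB k hk; omega) h)

end Pi

namespace Sg

theorem comp {P : Δ → Prop} (hP : Sg P) {f : Γ → Δ} (hf : CompMap f) : Sg fun γ => P (f γ) :=
  Pi.comp (P := fun δ => ¬ P δ) hP hf

theorem and {P Q : Γ → Prop} (hP : Sg P) (hQ : Sg Q) : Sg fun γ => P γ ∧ Q γ :=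
  (Pi.or hP hQ).of_iff fun _ => not_and_or

theorem or {P Q : Γ → Prop} (hP : Sg P) (hQ : Sg Q) : Sg fun γ => P γ ∨ Q γ :=
  (Pi.and hP hQ).of_iff fun _ => not_or

theorem ex {P : Γ → ℕ → Prop} (hP : Sg fun p : Γ × ℕ => P p.1 p.2) : Sg fun γ => ∃ k, P γ k :=
  (Pi.all (P := fun γ k => ¬ P γ k) hP).of_iff fun _ => not_exists

theorem ex_list {P : Γ → List ℕ → Prop} (hP : Sg fun p : Γ × List ℕ => P p.1 p.2) :
    Sg fun γ => ∃ l, P γ l :=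
  (Pi.all_list (P := fun γ k => ¬ P γ k) hP).of_iff fun _ => not_exists

theorem ball {P : Γ → ℕ → Prop} (hP : Sg fun p : Γ × ℕ => P p.1 p.2) {b : Γ → ℕ}
    (hb : CompMap b) : Sg fun γ => ∀ k < b γ, P γ k :=
  (Pi.bex (P := fun γ k => ¬ P γ k) hP hb).of_iff fun _ => by push Not; rfl

theorem prim {p : α → Prop} (hp : PrimrecPred p) {f : Γ → α} (hf : CompMap f) :
    Sg fun γ => p (f γ) :=
  Pi.prim hp.not hf

end Sg

/-! ### Closure properties of Σ¹₁ and Δ¹₁. -/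

/-- Lightface `Σ¹₁` predicates on a context. -/
def Sig (P : Γ → Prop) : Prop :=
  ∃ Q : Γ × Baire → Prop, Pi Q ∧ ∀ γ, P γ ↔ ∃ y, Q (γ, y)

namespace Sig

theorem of_iff {P Q : Γ → Prop} (hP : Sig P) (h : ∀ γ, Q γ ↔ P γ) : Sig Q := by
  have : Q = P := funext fun γ => propext (h γ)
  rwa [this]

theorem of_pi {P : Γ → Prop} (hP : Pi P) : Sig P :=
  ⟨fun p => P p.1, hP.comp CompMap.fst, fun _ => by simp⟩

theorem prim {p : α → Prop} (hp : PrimrecPred p) {f : Γ → α} (hf : CompMap f) :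
    Sig fun γ => p (f γ) := of_pi (Pi.prim hp hf)

theorem comp {P : Δ → Prop} (hP : Sig P) {f : Γ → Δ} (hf : CompMap f) :
    Sig fun γ => P (f γ) := by
  obtain ⟨Q, hQ, H⟩ := hP
  exact ⟨fun p => Q (f p.1, p.2), hQ.comp (f := fun p : Γ × Baire => (f p.1, p.2))
    ((hf.comp CompMap.fst).pair CompMap.snd), fun γ => H _⟩

theorem or {P Q : Γ → Prop} (hP : Sig P) (hQ : Sig Q) : Sig fun γ => P γ ∨ Q γ := by
  obtain ⟨P', hP', H⟩ := hP
  obtain ⟨Q', hQ', H'⟩ := hQ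
  exact ⟨fun p => P' p ∨ Q' p, hP'.or hQ', fun γ => by simp only [H, H', exists_or]⟩

theorem ex_real {P : Γ → Baire → Prop} (hP : Sig fun p : Γ × Baire => P p.1 p.2) :
    Sig fun γ => ∃ x, P γ x := by
  obtain ⟨Q, hQ, H⟩ := hP
  refine ⟨fun p => Q ((p.1, fun n => (Nat.unpair (p.2 n)).1), fun n => (Nat.unpair (p.2 n)).2),
    ?_, fun γ => ?_⟩
  · refine hQ.comp (f := fun p : Γ × Baire =>
      ((p.1, fun n => (Nat.unpair (p.2 n)).1), fun n => (Nat.unpair (p.2 n)).2)) ?_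
    exact (CompMap.fst.pair (CompMap.real_fst.comp CompMap.snd)).pair
      (CompMap.real_snd.comp CompMap.snd)
  · constructor
    · rintro ⟨x, hx⟩
      obtain ⟨y, hy⟩ := (H (γ, x)).1 hx
      exact ⟨fun n => Nat.pair (x n) (y n), by simpa using hy⟩
    · rintro ⟨y, hy⟩
      exact ⟨_, (H (γ, _)).2 ⟨_, hy⟩⟩

theorem ex {P : Γ → ℕ → Prop} (hP : Sig fun p : Γ × ℕ => P p.1 p.2) :
    Sig fun γ => ∃ k, P γ k := by
  have h : Sig fun p : Γ × Baire => P p.1 (p.2 0) :=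
    hP.comp (f := fun p : Γ × Baire => (p.1, p.2 0))
      (CompMap.fst.pair (CompMap.app.comp (CompMap.snd.pair (CompMap.const 0))))
  exact (ex_real (P := fun γ x => P γ (x 0)) h).of_iff fun γ =>
    ⟨fun ⟨k, hk⟩ => ⟨fun _ => k, hk⟩, fun ⟨x, hx⟩ => ⟨_, hx⟩⟩

theorem all {P : Γ → ℕ → Prop} (hP : Sig fun p : Γ × ℕ => P p.1 p.2) :
    Sig fun γ => ∀ k, P γ k := by
  obtain ⟨Q, hQ, H⟩ := hP
  -- Countable choice: the columns of a single real witness all instances `k` at once.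
  refine ⟨fun p => ∀ k, Q ((p.1, k), fun n => p.2 (Nat.pair k n)), ?_, fun γ => ?_⟩
  · refine Pi.all (P := fun (p : Γ × Baire) k => Q ((p.1, k), fun n => p.2 (Nat.pair k n))) ?_
    refine hQ.comp (f := fun p : (Γ × Baire) × ℕ =>
      ((p.1.1, p.2), fun n => p.1.2 (Nat.pair p.2 n))) ?_
    exact ((CompMap.fst.comp CompMap.fst).pair CompMap.snd).pair
      (CompMap.col.comp ((CompMap.snd.comp CompMap.fst).pair CompMap.snd))
  · constructor
    · intro h
      choose y hy using fun k => (H (γ, k)).1 (h k)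
      exact ⟨fun n => y (Nat.unpair n).1 (Nat.unpair n).2, fun k => by simpa using hy k⟩
    · rintro ⟨y, hy⟩ k
      exact (H (γ, k)).2 ⟨_, hy k⟩

theorem and {P Q : Γ → Prop} (hP : Sig P) (hQ : Sig Q) : Sig fun γ => P γ ∧ Q γ := by
  obtain ⟨P', hP', H⟩ := hP
  obtain ⟨Q', hQ', H'⟩ := hQ
  have h : Sig fun γ => ∃ x, ∃ y, P' (γ, x) ∧ Q' (γ, y) := by
    refine ex_real (P := fun γ x => ∃ y, P' (γ, x) ∧ Q' (γ, y)) (ex_real (Γ := Γ × Baire)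
      (P := fun p y => P' (p.1, p.2) ∧ Q' (p.1, y)) (of_pi (Pi.and ?_ ?_)))
    · exact hP'.comp (f := fun p : (Γ × Baire) × Baire => (p.1.1, p.1.2)) CompMap.fst
    · exact hQ'.comp (f := fun p : (Γ × Baire) × Baire => (p.1.1, p.2))
        ((CompMap.fst.comp CompMap.fst).pair CompMap.snd)
  exact h.of_iff fun γ => by simp only [H, H', exists_and_left, exists_and_right]

theorem of_sg {P : Γ → Prop} (hP : Sg P) : Sig P := by
  obtain ⟨R, hR, H⟩ := hP
  have h : Sig fun γ : Γ => ∃ n, ¬ R (initSeg (code γ) n) := by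
    refine ex (P := fun γ n => ¬ R (initSeg (code γ) n))
      (of_pi (Pi.prim hR.not (f := fun p : Γ × ℕ => initSeg (code p.1) p.2) ?_))
    exact CompMap.initSeg.comp ((CompMap.codeReal.comp CompMap.fst).pair CompMap.snd)
  refine h.of_iff fun γ => ?_
  have : ¬ P γ ↔ _ := H γ
  rw [← not_iff_not, this]
  push Not
  rfl

theorem all_list {P : Γ → List ℕ → Prop} (hP : Sig fun p : Γ × List ℕ => P p.1 p.2) :
    Sig fun γ => ∀ l, P γ l := by
  have h : Sig fun p : Γ × ℕ => P p.1 (Denumerable.ofNat (List ℕ) p.2) :=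
    hP.comp (f := fun p : Γ × ℕ => (p.1, Denumerable.ofNat (List ℕ) p.2))
      (CompMap.fst.pair ((CompMap.prim (Primrec.ofNat (List ℕ))).comp CompMap.snd))
  refine (all (P := fun γ k => P γ (Denumerable.ofNat (List ℕ) k)) h).of_iff fun γ =>
    ⟨fun h k => h _, fun h l => ?_⟩
  have := h (encode l)
  rwa [Denumerable.ofNat_encode] at this

end Sig

/-- Predicates that are both lightface `Σ¹₁` and `Π¹₁`. -/
def Del (P : Γ → Prop) : Prop := Sig P ∧ Sig fun γ => ¬ P γ

namespace Del

theorem not {P : Γ → Prop} (hP : Del P) : Del fun γ => ¬ P γ :=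
  ⟨hP.2, hP.1.of_iff fun _ => not_not⟩

theorem of_iff {P Q : Γ → Prop} (hP : Del P) (h : ∀ γ, Q γ ↔ P γ) : Del Q := by
  have : Q = P := funext fun γ => propext (h γ)
  rwa [this]

theorem comp {P : Δ → Prop} (hP : Del P) {f : Γ → Δ} (hf : CompMap f) : Del fun γ => P (f γ) :=
  ⟨hP.1.comp hf, Sig.comp (P := fun δ => ¬ P δ) hP.2 hf⟩

theorem prim {p : α → Prop} (hp : PrimrecPred p) {f : Γ → α} (hf : CompMap f) :
    Del fun γ => p (f γ) := ⟨Sig.prim hp hf, Sig.prim hp.not hf⟩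

theorem of_sg {P : Γ → Prop} (hP : Sg P) : Del P := ⟨Sig.of_sg hP, Sig.of_pi hP⟩

theorem and {P Q : Γ → Prop} (hP : Del P) (hQ : Del Q) : Del fun γ => P γ ∧ Q γ :=
  ⟨hP.1.and hQ.1, (hP.2.or hQ.2).of_iff fun _ => not_and_or⟩

theorem or {P Q : Γ → Prop} (hP : Del P) (hQ : Del Q) : Del fun γ => P γ ∨ Q γ :=
  ⟨hP.1.or hQ.1, (hP.2.and hQ.2).of_iff fun _ => not_or⟩

theorem imp {P Q : Γ → Prop} (hP : Del P) (hQ : Del Q) : Del fun γ => P γ → Q γ :=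
  (hP.not.or hQ).of_iff fun _ => imp_iff_not_or

theorem iff {P Q : Γ → Prop} (hP : Del P) (hQ : Del Q) : Del fun γ => (P γ ↔ Q γ) :=
  ((hP.imp hQ).and (hQ.imp hP)).of_iff fun _ => iff_def

theorem all {P : Γ → ℕ → Prop} (hP : Del fun p : Γ × ℕ => P p.1 p.2) :
    Del fun γ => ∀ k, P γ k :=
  ⟨Sig.all hP.1, (Sig.ex (P := fun γ k => ¬ P γ k) hP.2).of_iff fun _ => not_forall⟩

theorem ex {P : Γ → ℕ → Prop} (hP : Del fun p : Γ × ℕ => P p.1 p.2) :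
    Del fun γ => ∃ k, P γ k :=
  ⟨Sig.ex hP.1, (Sig.all (P := fun γ k => ¬ P γ k) hP.2).of_iff fun _ => not_exists⟩

end Del

/-! ### Automation for effective maps. -/

/-- Evaluation of a real. -/
def ev (x : Baire) (n : ℕ) : ℕ := x n

attribute [fun_prop] CompMap
attribute [fun_prop] CompMap.id CompMap.comp CompMap.pair CompMap.const

namespace CompMap

@[fun_prop] theorem fst' {f : Γ → Δ × Θ} (hf : CompMap f) : CompMap fun γ => (f γ).1 :=
  fst.comp hf

@[fun_prop] theorem snd' {f : Γ → Δ × Θ} (hf : CompMap f) : CompMap fun γ => (f γ).2 :=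
  snd.comp hf

@[fun_prop] theorem natPair {f g : Γ → ℕ} (hf : CompMap f) (hg : CompMap g) :
    CompMap fun γ => Nat.pair (f γ) (g γ) := prim₂ Primrec₂.natPair hf hg

@[fun_prop] theorem unpair {f : Γ → ℕ} (hf : CompMap f) : CompMap fun γ => Nat.unpair (f γ) :=
  (prim Primrec.unpair).comp hf

@[fun_prop] theorem add {f g : Γ → ℕ} (hf : CompMap f) (hg : CompMap g) :
    CompMap fun γ => f γ + g γ := prim₂ Primrec.nat_add hf hg

@[fun_prop] theorem mul {f g : Γ → ℕ} (hf : CompMap f) (hg : CompMap g) :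
    CompMap fun γ => f γ * g γ := prim₂ Primrec.nat_mul hf hg

@[fun_prop] theorem length {f : Γ → List ℕ} (hf : CompMap f) :
    CompMap fun γ => (f γ).length := (prim Primrec.list_length).comp hf

@[fun_prop] theorem take {f : Γ → List ℕ} {g : Γ → ℕ} (hf : CompMap f) (hg : CompMap g) :
    CompMap fun γ => (f γ).take (g γ) := prim₂ Primrec.list_take hg hf

@[fun_prop] theorem concat {f : Γ → List ℕ} {g : Γ → ℕ} (hf : CompMap f) (hg : CompMap g) :
    CompMap fun γ => f γ ++ [g γ] := prim₂ Primrec.list_concat hf hg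

@[fun_prop] theorem encode {f : Γ → α} (hf : CompMap f) :
    CompMap fun γ => Encodable.encode (f γ) := (prim Primrec.encode).comp hf

@[fun_prop] theorem getD {f : Γ → List ℕ} {g : Γ → ℕ} (hf : CompMap f) (hg : CompMap g) :
    CompMap fun γ => (f γ).getD (g γ) 0 := prim₂ (Primrec.list_getD 0) hf hg

@[fun_prop] theorem initSeg' {f : Γ → Baire} {g : Γ → ℕ} (hf : CompMap f) (hg : CompMap g) :
    CompMap fun γ => EffDST.initSeg (f γ) (g γ) := initSeg.comp (hf.pair hg)

@[fun_prop] theorem ev {f : Γ → Baire} {g : Γ → ℕ} (hf : CompMap f) (hg : CompMap g) :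
    CompMap fun γ => EffDST.ev (f γ) (g γ) := app.comp (hf.pair hg)

@[fun_prop] theorem code {f : Γ → Δ} (hf : CompMap f) : CompMap fun γ => Ctx.code (f γ) :=
  codeReal.comp hf

end CompMap

theorem primrecPred_eq : PrimrecPred fun p : ℕ × ℕ => p.1 = p.2 :=
  Primrec.eq.comp Primrec.fst Primrec.snd

theorem primrecPred_lt : PrimrecPred fun p : ℕ × ℕ => p.1 < p.2 :=
  Primrec.nat_lt.comp Primrec.fst Primrec.snd

theorem Sg.eq {f g : Γ → ℕ} (hf : CompMap f) (hg : CompMap g) : Sg fun γ => f γ = g γ :=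
  Sg.prim primrecPred_eq (hf.pair hg)

theorem Del.eq {f g : Γ → ℕ} (hf : CompMap f) (hg : CompMap g) : Del fun γ => f γ = g γ :=
  Del.prim primrecPred_eq (hf.pair hg)

theorem Del.lt {f g : Γ → ℕ} (hf : CompMap f) (hg : CompMap g) : Del fun γ => f γ < g γ :=
  Del.prim primrecPred_lt (hf.pair hg)

/-! ### Turing reducibility as Σ⁰₁ definability of the graph. -/

theorem mem_natRec_iff {s : Part ℕ} {h : ℕ → ℕ → Part ℕ} {n m : ℕ} :
    m ∈ (Nat.rec s (fun y IH => IH >>= fun i => h y i) n : Part ℕ) ↔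
      ∃ l : List ℕ, l.getD 0 0 ∈ s ∧ (∀ y < n, l.getD (y + 1) 0 ∈ h y (l.getD y 0)) ∧
        l.getD n 0 = m := by
  constructor
  · intro hm
    suffices H : ∃ v : ℕ → ℕ, v 0 ∈ s ∧ (∀ y < n, v (y + 1) ∈ h y (v y)) ∧ v n = m by
      obtain ⟨v, h0, h1, h2⟩ := H
      have key : ∀ i, i < n + 1 → (initSeg v (n + 1)).getD i 0 = v i := fun i hi => by
        rw [List.getD_eq_getElem?_getD, getElem?_initSeg _ hi]; rfl
      refine ⟨initSeg v (n + 1), ?_, fun y hy => ?_, ?_⟩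
      · rwa [key 0 (by omega)]
      · rw [key _ (by omega), key _ (by omega)]
        exact h1 y hy
      · rw [key _ (by omega), h2]
    induction n generalizing m with
    | zero => exact ⟨fun _ => m, hm, by simp, rfl⟩
    | succ n ih =>
      obtain ⟨i, hi, him⟩ := Part.mem_bind_iff.1 hm
      obtain ⟨v, h0, h1, h2⟩ := ih hi
      refine ⟨fun j => if j ≤ n then v j else m, by simpa using h0, fun y hy => ?_, by simp⟩
      rcases Nat.lt_succ_iff_lt_or_eq.1 hy with hy | rfl
      · simpa [hy.le, Nat.succ_le_of_lt hy] using h1 y hy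
      · simpa [h2] using him
  · rintro ⟨l, h0, h1, rfl⟩
    induction n with
    | zero => exact h0
    | succ n ih =>
      exact Part.mem_bind_iff.2 ⟨_, ih fun y hy => h1 y (by omega), h1 n (by omega)⟩

/-- Induction on the generation of the functions partial recursive in `x`. Primitive recursion
becomes the existence of a finite list of intermediate values; minimization uses closure of Σ⁰₁
under bounded universal quantification. -/
theorem exists_sg_graph {x : Baire} {f : ℕ →. ℕ} (h : Nat.RecursiveIn {(x : ℕ →. ℕ)} f) :
    ∃ Q : (ℕ × ℕ) × Baire → Prop, Sg Q ∧ ∀ n m, m ∈ f n ↔ Q ((n, m), x) := by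
  induction h with
  | zero =>
    exact ⟨fun p => p.1.2 = 0, Sg.eq (by fun_prop) (by fun_prop), fun n m => Part.mem_some_iff⟩
  | succ =>
    exact ⟨fun p => p.1.2 = p.1.1 + 1, Sg.eq (by fun_prop) (by fun_prop),
      fun n m => Part.mem_some_iff⟩
  | left =>
    exact ⟨fun p => p.1.2 = (Nat.unpair p.1.1).1, Sg.eq (by fun_prop) (by fun_prop),
      fun n m => Part.mem_some_iff⟩
  | right =>
    exact ⟨fun p => p.1.2 = (Nat.unpair p.1.1).2, Sg.eq (by fun_prop) (by fun_prop),
      fun n m => Part.mem_some_iff⟩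
  | oracle g hg =>
    obtain rfl := hg
    exact ⟨fun p => p.1.2 = ev p.2 p.1.1, Sg.eq (by fun_prop) (by fun_prop),
      fun n m => Part.mem_some_iff⟩
  | @pair f h _ _ ihf ihh =>
    obtain ⟨Q, hQ, H⟩ := ihf
    obtain ⟨Q', hQ', H'⟩ := ihh
    refine ⟨fun p => Q ((p.1.1, (Nat.unpair p.1.2).1), p.2) ∧
      Q' ((p.1.1, (Nat.unpair p.1.2).2), p.2), ?_, fun n m => ?_⟩
    · exact (hQ.comp (f := fun p : (ℕ × ℕ) × Baire => ((p.1.1, (Nat.unpair p.1.2).1), p.2))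
        (by fun_prop)).and (hQ'.comp
        (f := fun p : (ℕ × ℕ) × Baire => ((p.1.1, (Nat.unpair p.1.2).2), p.2)) (by fun_prop))
    · simp only [← H, ← H', seq_eq_bind_map, map_eq_bind_pure_comp, Part.bind_eq_bind,
        Part.mem_bind_iff]
      constructor
      · rintro ⟨g, ⟨a, ha, hg⟩, b, hb, hm⟩
        obtain rfl := Part.mem_some_iff.1 hg
        obtain rfl := Part.mem_some_iff.1 hm
        simpa using ⟨ha, hb⟩
      · rintro ⟨h1, h2⟩
        exact ⟨_, ⟨_, h1, Part.mem_some _⟩, _, h2, by simp⟩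
  | @comp f h _ _ ihf ihh =>
    obtain ⟨Q, hQ, H⟩ := ihf
    obtain ⟨Q', hQ', H'⟩ := ihh
    refine ⟨fun p => ∃ k, Q' ((p.1.1, k), p.2) ∧ Q ((k, p.1.2), p.2), ?_, fun n m => ?_⟩
    · refine Sg.ex ?_
      exact (hQ'.comp (f := fun p : ((ℕ × ℕ) × Baire) × ℕ => ((p.1.1.1, p.2), p.1.2))
        (by fun_prop)).and (hQ.comp
        (f := fun p : ((ℕ × ℕ) × Baire) × ℕ => ((p.2, p.1.1.2), p.1.2)) (by fun_prop))
    · simp only [← H, ← H']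
      exact Part.mem_bind_iff
  | @prec f h _ _ ihf ihh =>
    obtain ⟨Q, hQ, H⟩ := ihf
    obtain ⟨Q', hQ', H'⟩ := ihh
    refine ⟨fun p => ∃ l : List ℕ, Q (((Nat.unpair p.1.1).1, l.getD 0 0), p.2) ∧
      (∀ y < (Nat.unpair p.1.1).2, Q' ((Nat.pair (Nat.unpair p.1.1).1 (Nat.pair y (l.getD y 0)),
        l.getD (y + 1) 0), p.2)) ∧ l.getD (Nat.unpair p.1.1).2 0 = p.1.2, ?_, fun n m => ?_⟩
    · refine Sg.ex_list ((hQ.comp (f := fun p : ((ℕ × ℕ) × Baire) × List ℕ =>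
        (((Nat.unpair p.1.1.1).1, p.2.getD 0 0), p.1.2)) (by fun_prop)).and
        (Sg.and (Sg.ball ?_ (by fun_prop)) (Sg.eq (by fun_prop) (by fun_prop))))
      exact hQ'.comp (f := fun q : (((ℕ × ℕ) × Baire) × List ℕ) × ℕ =>
        ((Nat.pair (Nat.unpair q.1.1.1.1).1 (Nat.pair q.2 (q.1.2.getD q.2 0)),
          q.1.2.getD (q.2 + 1) 0), q.1.1.2)) (by fun_prop)
    · simp only [← H, ← H']
      exact mem_natRec_iff
        (h := fun y i => h (Nat.pair (Nat.unpair n).1 (Nat.pair y i)))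
  | @rfind f _ ihf =>
    obtain ⟨Q, hQ, H⟩ := ihf
    refine ⟨fun p => Q ((Nat.pair p.1.1 p.1.2, 0), p.2) ∧ ∀ k < p.1.2, ∃ v,
      Q ((Nat.pair p.1.1 k, v + 1), p.2), ?_, fun n m => ?_⟩
    · refine (hQ.comp (f := fun p : (ℕ × ℕ) × Baire => ((Nat.pair p.1.1 p.1.2, 0), p.2))
        (by fun_prop)).and (Sg.ball (Sg.ex ?_) (by fun_prop))
      exact hQ.comp (f := fun p : (((ℕ × ℕ) × Baire) × ℕ) × ℕ =>
        ((Nat.pair p.1.1.1.1 p.1.2, p.2 + 1), p.1.1.2)) (by fun_prop)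
    · simp only [← H]
      refine Nat.mem_rfind.trans (and_congr (by simp) (forall₂_congr fun k _ => ?_))
      constructor
      · intro hk
        obtain ⟨v, hv, hv0⟩ := (Part.mem_map_iff _).1 hk
        obtain ⟨w, rfl⟩ := Nat.exists_eq_succ_of_ne_zero (by simpa using hv0 : v ≠ 0)
        exact ⟨w, hv⟩
      · rintro ⟨v, hv⟩
        exact (Part.mem_map_iff _).2 ⟨_, hv, by simp⟩

theorem Nat.RecursiveIn.comp_total {O : Set (ℕ →. ℕ)} {f g : ℕ → ℕ}
    (hf : Nat.RecursiveIn O fun n => Part.some (f n))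
    (hg : Nat.RecursiveIn O fun n => Part.some (g n)) :
    Nat.RecursiveIn O fun n => Part.some (f (g n)) :=
  (hf.comp hg).of_eq fun _ => Part.bind_some _ _

theorem Nat.RecursiveIn.pair_total {O : Set (ℕ →. ℕ)} {f g : ℕ → ℕ}
    (hf : Nat.RecursiveIn O fun n => Part.some (f n))
    (hg : Nat.RecursiveIn O fun n => Part.some (g n)) :
    Nat.RecursiveIn O fun n => Part.some (Nat.pair (f n) (g n)) :=
  (hf.pair hg).of_eq fun n => by simp [seq_eq_bind_map]

theorem Primrec.recursiveIn {O : Set (ℕ →. ℕ)} {f : ℕ → ℕ} (hf : Primrec f) :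
    Nat.RecursiveIn O fun n => Part.some (f n) :=
  (Primrec.nat_iff.1 hf).recursiveIn

theorem recursiveIn_initSeg (x : Baire) :
    Nat.RecursiveIn {(x : ℕ →. ℕ)} fun k => Part.some (encode (initSeg x k)) := by
  have h1 : Primrec fun q => encode (Denumerable.ofNat (List ℕ) (Nat.unpair q).1 ++
      [(Nat.unpair q).2]) :=
    Primrec.encode.comp (Primrec.list_concat.comp ((Primrec.ofNat (List ℕ)).comp
      (Primrec.fst.comp Primrec.unpair)) (Primrec.snd.comp Primrec.unpair))
  have h2 : Primrec fun q => (Nat.unpair (Nat.unpair q).2).1 :=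
    Primrec.fst.comp (Primrec.unpair.comp (Primrec.snd.comp Primrec.unpair))
  have h3 : Primrec fun q => (Nat.unpair (Nat.unpair q).2).2 :=
    Primrec.snd.comp (Primrec.unpair.comp (Primrec.snd.comp Primrec.unpair))
  have hx : Nat.RecursiveIn {(x : ℕ →. ℕ)} fun n => Part.some (x n) :=
    Nat.RecursiveIn.oracle (x : ℕ →. ℕ) rfl
  have hstep := Nat.RecursiveIn.comp_total (Primrec.recursiveIn h1)
    (Nat.RecursiveIn.pair_total (Primrec.recursiveIn h3)
      (Nat.RecursiveIn.comp_total hx (Primrec.recursiveIn h2)))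
  have h0 : Nat.RecursiveIn {(x : ℕ →. ℕ)} fun _ => Part.some (encode ([] : List ℕ)) :=
    Primrec.recursiveIn (Primrec.const _)
  have h5 : Primrec fun k => Nat.pair 0 k := Primrec₂.natPair.comp (Primrec.const 0) Primrec.id
  refine ((h0.prec hstep).comp (Primrec.recursiveIn h5)).of_eq fun k => ?_
  simp only [Part.bind_eq_bind, Part.bind_some, Nat.unpair_pair]
  induction k with
  | zero => rfl
  | succ k ih => simp only [ih, Part.bind_some, Denumerable.ofNat_encode, initSeg_succ]

/-- To compute `y n`, search for a pair of a value `m` and a length `k` at which the Σ⁰₁ condition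
is confirmed; the search ends because `y` is total. -/
theorem TuringLE.of_sg {x y : Baire} {Q : (ℕ × ℕ) × Baire → Prop} (hQ : Sg Q)
    (h : ∀ n m, y n = m ↔ Q ((n, m), x)) : TuringLE y x := by
  obtain ⟨R, ⟨hd, hR⟩, H⟩ := hQ
  refine RecursiveIn.iff_nat.2 ?_
  have hfst : Primrec fun q : ℕ => (Nat.unpair q).1 := Primrec.fst.comp Primrec.unpair
  have hsnd : Primrec fun q : ℕ => (Nat.unpair q).2 := Primrec.snd.comp Primrec.unpair
  have hn : Primrec fun q : ℕ => (Nat.unpair (Nat.unpair q).1).1 := hfst.comp hfst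
  have hm : Primrec fun q : ℕ => (Nat.unpair (Nat.unpair (Nat.unpair q).1).2).1 :=
    hfst.comp (hsnd.comp hfst)
  have hmap : Primrec fun q : ℕ => (Denumerable.ofNat (List ℕ) (Nat.unpair q).2).map
      fun v => Nat.pair (Nat.pair (Nat.unpair (Nat.unpair q).1).1
        (Nat.unpair (Nat.unpair (Nat.unpair q).1).2).1) v := by
    refine Primrec.list_map ((Primrec.ofNat (List ℕ)).comp hsnd) ?_
    exact Primrec₂.natPair.comp
      ((Primrec₂.natPair.comp hn hm).comp Primrec.fst) Primrec.snd
  -- The value is 0 exactly when `R` fails, that is, when the condition is confirmed; `rfind`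
  -- searches for a zero.
  have hχ : Primrec fun q : ℕ => (decide (R ((Denumerable.ofNat (List ℕ) (Nat.unpair q).2).map
      fun v => Nat.pair (Nat.pair (Nat.unpair (Nat.unpair q).1).1
        (Nat.unpair (Nat.unpair (Nat.unpair q).1).2).1) v))).toNat :=
    (Primrec.dom_bool Bool.toNat).comp (hR.comp hmap)
  have hF := Nat.RecursiveIn.comp_total (Primrec.recursiveIn hχ)
    (Nat.RecursiveIn.pair_total (Primrec.recursiveIn Primrec.id)
      (Nat.RecursiveIn.comp_total (recursiveIn_initSeg x)
        (Primrec.recursiveIn (hsnd.comp hsnd))))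
  have hseg : ∀ n m k, (initSeg x k).map (fun v => Nat.pair (Nat.pair n m) v) =
      initSeg (code ((n, m), x)) k := fun n m k => by rw [map_initSeg]; rfl
  replace hF := hF.of_eq (g := fun q => Part.some (decide (R (initSeg (code (((Nat.unpair q).1,
    (Nat.unpair (Nat.unpair q).2).1), x)) (Nat.unpair (Nat.unpair q).2).2))).toNat)
    fun q => by simp only [Nat.unpair_pair, Denumerable.ofNat_encode, hseg, id]
  have hQ' : ∀ n m, y n = m ↔ ∃ k, ¬ R (initSeg (code ((n, m), x)) k) := fun n m => by
    have : ¬ Q ((n, m), x) ↔ _ := H ((n, m), x)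
    rw [h, ← not_iff_not, this]
    push Not
    rfl
  refine ((Primrec.recursiveIn hfst).comp hF.rfind).of_eq_tot fun n => ?_
  have hdom : ∃ q, ¬ R (initSeg (code ((n, (Nat.unpair q).1), x)) (Nat.unpair q).2) := by
    obtain ⟨k, hk⟩ := (hQ' n (y n)).1 rfl
    exact ⟨Nat.pair (y n) k, by simpa using hk⟩
  classical
  refine Part.mem_bind_iff.2 ⟨Nat.find hdom, Nat.mem_rfind.2 ⟨?_, fun {m} hm => ?_⟩,
    Part.mem_some_iff.2 ((hQ' _ _).2 ⟨_, Nat.find_spec hdom⟩)⟩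
  · refine (Part.mem_map_iff _).2 ⟨_, Part.mem_some _, ?_⟩
    simpa using Nat.find_spec hdom
  · refine (Part.mem_map_iff _).2 ⟨_, Part.mem_some _, ?_⟩
    simpa using Nat.find_min hdom hm

theorem TuringLE.iff_sg {x y : Baire} : TuringLE y x ↔
    ∃ Q : (ℕ × ℕ) × Baire → Prop, Sg Q ∧ ∀ n m, y n = m ↔ Q ((n, m), x) := by
  refine ⟨fun h => ?_, fun ⟨Q, hQ, h⟩ => TuringLE.of_sg hQ h⟩
  obtain ⟨Q, hQ, H⟩ := exists_sg_graph (RecursiveIn.iff_nat.1 h)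
  exact ⟨Q, hQ, fun n m => by rw [← H]; exact eq_comm.trans Part.mem_some_iff.symm⟩

/-! ### Program indices and Turing saturation. -/

open Nat.Partrec (Code)

/-- The program `e` halts on input `i` within `k` steps. -/
def Halts (p : (ℕ × ℕ) × ℕ) : Prop :=
  (Code.evaln p.1.1 (Denumerable.ofNat Code p.1.2) p.2).isSome = true

theorem primrecPred_halts : PrimrecPred Halts :=
  Primrec.eq.comp (Primrec.option_isSome.comp (Code.primrec_evaln.comp (Primrec.pair
    (Primrec.pair (Primrec.fst.comp Primrec.fst)
      ((Primrec.ofNat Code).comp (Primrec.snd.comp Primrec.fst))) Primrec.snd)))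
    (Primrec.const true)

theorem REPred.exists_index {α : Type} [Primcodable α] {p : α → Prop} (hp : REPred p) :
    ∃ e, ∀ a, p a ↔ ∃ k, Halts ((k, e), encode a) := by
  obtain ⟨c, hc⟩ := Code.exists_code.1 hp
  refine ⟨encode c, fun a => ?_⟩
  have h1 : p a ↔ (c.eval (encode a)).Dom := by
    rw [hc]
    simp [Part.assert]
  rw [h1, Part.dom_iff_mem]
  simp only [Halts, Denumerable.ofNat_encode, Option.isSome_iff_exists, Code.evaln_complete]
  exact exists_comm

/-- A universal lightface `Σ⁰₁` predicate on pairs of numbers and a real. -/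
def TuringEnum (p : (ℕ × (ℕ × ℕ)) × Baire) : Prop :=
  ∃ i k, Halts ((k, p.1.1), encode (initSeg (code (p.1.2, p.2)) i))

theorem sg_turingEnum : Sg TuringEnum :=
  Sg.ex (Sg.ex (Sg.prim primrecPred_halts (f := fun p : (((ℕ × (ℕ × ℕ)) × Baire) × ℕ) × ℕ =>
    ((p.2, p.1.1.1.1), encode (initSeg (code (p.1.1.1.2, p.1.1.2)) p.1.2))) (by fun_prop)))

theorem Sg.exists_index {Q : (ℕ × ℕ) × Baire → Prop} (hQ : Sg Q) :
    ∃ e, ∀ p, Q p ↔ TuringEnum ((e, p.1), p.2) := by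
  obtain ⟨R, hR, H⟩ := hQ
  obtain ⟨e, he⟩ := REPred.exists_index hR.not.computablePred.to_re
  refine ⟨e, fun p => ?_⟩
  have : ¬ Q p ↔ _ := H p
  rw [← not_iff_not, this]
  simp only [TuringEnum, ← he]
  push Not
  rfl

/-- The program `e` with oracle `x` computes the real `y`. -/
def TuringGraph (p : (ℕ × Baire) × Baire) : Prop :=
  ∀ n m, ev p.2 n = m ↔ TuringEnum ((p.1.1, (n, m)), p.1.2)

/-- The program `e` with oracle `x` computes some real. -/
def TuringTotal (p : ℕ × Baire) : Prop :=
  ∀ n, ∃ m, ∀ k, k = m ↔ TuringEnum ((p.1, (n, k)), p.2)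

theorem del_turingGraph : Del TuringGraph :=
  Del.all (Del.all (Del.iff (Del.eq (by fun_prop) (by fun_prop))
    ((Del.of_sg sg_turingEnum).comp (f := fun p : (((ℕ × Baire) × Baire) × ℕ) × ℕ =>
      ((p.1.1.1.1, (p.1.2, p.2)), p.1.1.1.2)) (by fun_prop))))

theorem del_turingTotal : Del TuringTotal :=
  Del.all (Del.ex (Del.all (Del.iff (Del.eq (by fun_prop) (by fun_prop))
    ((Del.of_sg sg_turingEnum).comp (f := fun p : (((ℕ × Baire) × ℕ) × ℕ) × ℕ =>
      ((p.1.1.1.1, (p.1.1.2, p.2)), p.1.1.1.2)) (by fun_prop)))))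

theorem turingTotal_iff {e : ℕ} {x : Baire} :
    TuringTotal (e, x) ↔ ∃ y, TuringGraph ((e, x), y) := by
  constructor
  · intro h
    choose y hy using h
    exact ⟨y, fun n m => eq_comm.trans (hy n m)⟩
  · rintro ⟨y, hy⟩ n
    exact ⟨y n, fun k => eq_comm.trans (hy n k)⟩

theorem TuringGraph.unique {e : ℕ} {x y z : Baire} (hy : TuringGraph ((e, x), y))
    (hz : TuringGraph ((e, x), z)) : y = z :=
  funext fun n => (hy n (z n)).2 ((hz n (z n)).1 rfl)

theorem turingLE_iff {x y : Baire} : TuringLE y x ↔ ∃ e, TuringGraph ((e, x), y) := by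
  rw [TuringLE.iff_sg]
  constructor
  · rintro ⟨Q, hQ, h⟩
    obtain ⟨e, he⟩ := hQ.exists_index
    exact ⟨e, fun n m => (h n m).trans (he _)⟩
  · rintro ⟨e, he⟩
    exact ⟨fun p => TuringEnum ((e, p.1), p.2), sg_turingEnum.comp
      (f := fun p : (ℕ × ℕ) × Baire => ((e, p.1), p.2)) (by fun_prop), he⟩

theorem del_turingLE : Del fun p : Baire × Baire => TuringLE p.1 p.2 :=
  (Del.ex (P := fun (p : Baire × Baire) e => TuringGraph ((e, p.2), p.1))
    (del_turingGraph.comp (f := fun p : (Baire × Baire) × ℕ => ((p.2, p.1.2), p.1.1))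
      (by fun_prop))).of_iff fun _ => turingLE_iff

theorem TuringLE.trans {x y z : Baire} (h : TuringLE x y) (h' : TuringLE y z) : TuringLE x z :=
  TuringReducible.trans h h'

theorem TuringEquiv.symm {x y : Baire} (h : TuringEquiv x y) : TuringEquiv y x := ⟨h.2, h.1⟩

theorem TuringEquiv.trans {x y z : Baire} (h : TuringEquiv x y) (h' : TuringEquiv y z) :
    TuringEquiv x z := ⟨TuringLE.trans h.1 h'.1, TuringLE.trans h'.2 h.2⟩

/-- The Turing saturation of a set of reals. -/
def turingSat (B : Set Baire) : Set Baire := {x | ∃ y ∈ B, TuringEquiv x y}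

theorem turingClosed_turingSat (B : Set Baire) : TuringClosed (turingSat B) := by
  rintro x y hxy ⟨z, hz, hxz⟩
  exact ⟨z, hz, hxy.symm.trans hxz⟩

/-- The reals computable from `x` are enumerated by programs, so the real quantifier in the
saturation can be traded for a number quantifier. -/
theorem del_turingSat {B : Set Baire} (hB : Del (· ∈ B)) : Del (· ∈ turingSat B) := by
  have hG : Del fun p : (Baire × ℕ) × Baire => TuringGraph ((p.1.2, p.1.1), p.2) :=
    del_turingGraph.comp (f := fun p : (Baire × ℕ) × Baire => ((p.1.2, p.1.1), p.2))
      (by fun_prop)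
  have hBc : Del fun p : (Baire × ℕ) × Baire => p.2 ∈ B := hB.comp CompMap.snd
  have hL : Del fun p : (Baire × ℕ) × Baire => TuringLE p.1.1 p.2 :=
    del_turingLE.comp (f := fun p : (Baire × ℕ) × Baire => (p.1.1, p.2)) (by fun_prop)
  constructor
  · refine Sig.of_iff (P := fun x => ∃ e y, TuringGraph ((e, x), y) ∧ y ∈ B ∧ TuringLE x y)
      (Sig.ex (Sig.ex_real (hG.and (hBc.and hL)).1)) fun x => ?_
    constructor
    · rintro ⟨y, hy, h1, h2⟩
      obtain ⟨e, he⟩ := turingLE_iff.1 h2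
      exact ⟨e, y, he, hy, h1⟩
    · rintro ⟨e, y, he, hy, h1⟩
      exact ⟨y, hy, h1, turingLE_iff.2 ⟨e, he⟩⟩
  -- A total program computes exactly one real, so "every real computed by `e`" may be replaced by
  -- "some real computed by `e`", which keeps the complement Σ¹₁.
  · refine Sig.of_iff (P := fun x => ∀ e, ¬ TuringTotal (e, x) ∨
      ∃ y, TuringGraph ((e, x), y) ∧ ¬ (y ∈ B ∧ TuringLE x y)) ?_ fun x => ?_
    · refine Sig.all (Sig.or ?_ (Sig.ex_real (hG.and (hBc.and hL).not).1))
      exact (del_turingTotal.not.comp (f := fun p : Baire × ℕ => (p.2, p.1)) (by fun_prop)).1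
    · constructor
      · intro hx e
        by_cases ht : TuringTotal (e, x)
        · obtain ⟨y, hy⟩ := turingTotal_iff.1 ht
          exact Or.inr ⟨y, hy, fun h => hx ⟨y, h.1, h.2, turingLE_iff.2 ⟨e, hy⟩⟩⟩
        · exact Or.inl ht
      · rintro h ⟨y, hy, h1, h2⟩
        obtain ⟨e, he⟩ := turingLE_iff.1 h2
        rcases h e with h | ⟨z, hz, h⟩
        · exact h (turingTotal_iff.2 ⟨y, he⟩)
        · rw [hz.unique he] at h
          exact h ⟨hy, h1⟩

/-! ### Plays against a strategy in a prescribed degree. -/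

section Strategies

/-- The real coding a strategy. -/
def strategyReal (σ : Strategy) : Baire := fun k => σ (Denumerable.ofNat (List ℕ) k)

theorem TuringLE.of_even {x y : Baire} (h : ∀ n, y n = x (2 * n)) : TuringLE y x := by
  refine TuringLE.of_sg (Q := fun p => ev p.2 (2 * p.1.1) = p.1.2)
    (Sg.eq (by fun_prop) (by fun_prop)) fun n m => ?_
  rw [h]; rfl

theorem TuringLE.of_odd {x y : Baire} (h : ∀ n, y n = x (2 * n + 1)) : TuringLE y x := by
  refine TuringLE.of_sg (Q := fun p => ev p.2 (2 * p.1.1 + 1) = p.1.2)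
    (Sg.eq (by fun_prop) (by fun_prop)) fun n m => ?_
  rw [h]; rfl

theorem exists_real_step (f : ℕ → List ℕ → ℕ) : ∃ x : Baire, ∀ n, x n = f n (initSeg x n) := by
  let hist : ℕ → List ℕ := fun n => Nat.rec [] (fun i l => l ++ [f i l]) n
  have h : ∀ n, initSeg (fun i => f i (hist i)) n = hist n := by
    intro n
    induction n with
    | zero => rfl
    | succ n ih => rw [initSeg_succ, ih]
  exact ⟨fun i => f i (hist i), fun n => by rw [h]⟩

/-- Against the strategy `σ`, used at the positions `i` with `i + c` even, the moves of `y` produce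
a play of the same Turing degree as `y`, provided that `y` computes `σ`. -/
theorem exists_play {σ : Strategy} {y : Baire} (hσ : TuringLE (strategyReal σ) y) {c : ℕ}
    (hc : c < 2) : ∃ x, TuringEquiv x y ∧ ∀ i j, i + c = 2 * j → x i = σ (initSeg x i) := by
  -- With `c = 0` the strategy is I's and with `c = 1` it is II's; the opponent's `j`-th move is `y
  -- j`.
  obtain ⟨x, hx⟩ := exists_real_step fun i l => if (i + c) % 2 = 0 then σ l else y ((i + c) / 2)
  have hx0 : ∀ i j, i + c = 2 * j → x i = σ (initSeg x i) := fun i j h => by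
    rw [hx, if_pos (by omega)]
  have hx1 : ∀ i j, i + c = 2 * j + 1 → x i = y j := fun i j h => by
    rw [hx, if_neg (by omega), show (i + c) / 2 = j by omega]
  refine ⟨x, ⟨?_, ?_⟩, hx0⟩
  · obtain ⟨Q, hQ, H⟩ := TuringLE.iff_sg.1 hσ
    have hstep : ∀ n m, (∃ j, (n + c = 2 * j ∧ Q ((encode (initSeg x n), m), y)) ∨
        (n + c = 2 * j + 1 ∧ ev y j = m)) ↔ x n = m := by
      intro n m
      have hz : Q ((encode (initSeg x n), m), y) ↔ σ (initSeg x n) = m := by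
        rw [← H, strategyReal, Denumerable.ofNat_encode]
      rw [hz]
      constructor
      · rintro ⟨j, ⟨h, h'⟩ | ⟨h, h'⟩⟩
        · rw [hx0 n j h, h']
        · rw [hx1 n j h, ← h']; rfl
      · intro h
        rcases Nat.even_or_odd' (n + c) with ⟨j, hj | hj⟩
        · exact ⟨j, Or.inl ⟨hj, by rw [← hx0 n j hj, h]⟩⟩
        · exact ⟨j, Or.inr ⟨hj, by rw [← h, hx1 n j hj]; rfl⟩⟩
    -- The list `l` guesses the play before move `n`. Each entry is checked against the strategy or
    -- `y`, which forces `l` to be the true initial segment.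
    refine TuringLE.of_sg (Q := fun p => ∃ l : List ℕ, l.length = p.1.1 ∧
      (∀ i < p.1.1, ∃ j, (i + c = 2 * j ∧ Q ((encode (l.take i), l.getD i 0), p.2)) ∨
        (i + c = 2 * j + 1 ∧ ev p.2 j = l.getD i 0)) ∧
      ∃ j, (p.1.1 + c = 2 * j ∧ Q ((encode l, p.1.2), p.2)) ∨
        (p.1.1 + c = 2 * j + 1 ∧ ev p.2 j = p.1.2)) ?_ fun n m => ?_
    · refine Sg.ex_list (Sg.and (Sg.eq (by fun_prop) (by fun_prop)) (Sg.and
        (Sg.ball (Sg.ex (Sg.or (Sg.and (Sg.eq (by fun_prop) (by fun_prop)) ?_)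
          (Sg.and (Sg.eq (by fun_prop) (by fun_prop)) (Sg.eq (by fun_prop) (by fun_prop)))))
          (by fun_prop))
        (Sg.ex (Sg.or (Sg.and (Sg.eq (by fun_prop) (by fun_prop)) ?_)
          (Sg.and (Sg.eq (by fun_prop) (by fun_prop)) (Sg.eq (by fun_prop) (by fun_prop)))))))
      · exact hQ.comp (f := fun p : ((((ℕ × ℕ) × Baire) × List ℕ) × ℕ) × ℕ =>
          ((encode (p.1.1.2.take p.1.2), p.1.1.2.getD p.1.2 0), p.1.1.1.2)) (by fun_prop)
      · exact hQ.comp (f := fun p : (((ℕ × ℕ) × Baire) × List ℕ) × ℕ =>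
          ((encode p.1.2, p.1.1.1.2), p.1.1.2)) (by fun_prop)
    · constructor
      · intro h
        refine ⟨initSeg x n, by simp, fun i hi => ?_, (hstep n m).2 h⟩
        have h1 : (initSeg x n).getD i 0 = x i := by
          rw [List.getD_eq_getElem?_getD, getElem?_initSeg _ hi]; rfl
        rw [take_initSeg, min_eq_left hi.le, h1]
        exact (hstep i (x i)).2 rfl
      · rintro ⟨l, hl, h1, h2⟩
        dsimp only at hl h1 h2
        have key : ∀ i ≤ n, l.take i = initSeg x i := by
          intro i
          induction i with
          | zero => intro _; simp [initSeg_zero]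
          | succ i ih =>
            intro hi
            have h3 := h1 i (by omega)
            rw [ih (by omega)] at h3
            rw [initSeg_succ, (hstep i _).1 h3, ← ih (by omega), List.take_add_one]
            simp [List.getElem?_eq_getElem (show i < l.length by omega)]
        have hln : l = initSeg x n := by rw [← key n le_rfl, ← hl, List.take_length]
        rw [hln] at h2
        exact (hstep n m).1 h2
  · interval_cases c
    · exact TuringLE.of_odd fun n => (hx1 (2 * n + 1) n rfl).symm
    · exact TuringLE.of_even fun n => (hx1 (2 * n) n rfl).symm

end Strategies

/-! ### Indices for Σ¹₁ sets and agreement with the original pointclasses. -/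

/-- A universal lightface `Σ¹₁` predicate on numbers and reals. -/
def SigmaEnum (p : (ℕ × ℕ) × Baire) : Prop :=
  ∃ y, ∀ s t : List ℕ, ∀ k,
    ¬ Halts ((k, p.1.1), Nat.pair p.1.2 (Nat.pair (encode s) (encode t))) ∨
    (¬ encode (initSeg p.2 s.length) = encode s ∨ ¬ encode (initSeg y t.length) = encode t)

theorem sig_sigmaEnum : Sig SigmaEnum := by
  refine Sig.ex_real (Sig.all_list (Sig.all_list (Sig.all (Del.or (Del.not ?_) (Del.or
    (Del.not (Del.eq ?_ ?_)) (Del.not (Del.eq ?_ ?_)))).1)))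
  · exact Del.prim primrecPred_halts (f := fun p :
      (((((ℕ × ℕ) × Baire) × Baire) × List ℕ) × List ℕ) × ℕ => ((p.2, p.1.1.1.1.1.1),
        Nat.pair p.1.1.1.1.1.2 (Nat.pair (encode p.1.1.2) (encode p.1.2)))) (by fun_prop)
  all_goals fun_prop

theorem IsSigma11.exists_index {α : Type} [Primcodable α] {P : Set (α × Baire)}
    (hP : IsSigma11 P) : ∃ e, ∀ a x, (a, x) ∈ P ↔ SigmaEnum ((e, encode a), x) := by
  obtain ⟨F, ⟨W, hW, HW⟩, HP⟩ := hP
  obtain ⟨e, he⟩ := REPred.exists_index hW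
  refine ⟨e, fun a x => ?_⟩
  rw [HP]
  refine exists_congr fun y => ?_
  have := HW a x y
  rw [← not_iff_not, ← Set.mem_compl_iff, this]
  simp only [he, encode_prod_val, nbhd, Set.mem_ofPred_eq]
  push Not
  simp only [encode_inj]
  constructor
  · rintro ⟨s, t, ⟨k, hk⟩, h⟩
    exact ⟨s, t, k, hk, h⟩
  · rintro ⟨s, t, k, hk, h⟩
    exact ⟨s, t, ⟨k, hk⟩, h⟩

theorem IsSigma11Set.sig {A : Set Baire} (hA : IsSigma11Set A) : Sig (· ∈ A) := by
  obtain ⟨e, he⟩ := IsSigma11.exists_index hA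
  exact (sig_sigmaEnum.comp (f := fun x : Baire => ((e, encode ()), x)) (by fun_prop)).of_iff
    fun x => he () x

/-- Only the Π¹₁ half of the definition of the graph is kept, because that is the form to which
selection applies. -/
theorem HypLE.exists_index {x d : Baire} (h : HypLE x d) :
    ∃ e, ∀ n m, x n = m ↔ ¬ SigmaEnum ((e, Nat.pair n m), d) := by
  obtain ⟨_, Q, hQ, H⟩ := h
  obtain ⟨e, he⟩ := IsSigma11.exists_index hQ
  refine ⟨e, fun n m => ?_⟩
  have h1 : x n = m ↔ ((n, m), d) ∈ Q := H (n, m)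
  rw [h1, ← not_iff_not, not_not]
  exact he (n, m) d

theorem Sig.isSigma11Set {A : Set Baire} (hA : Sig (· ∈ A)) : IsSigma11Set A := by
  obtain ⟨Q, ⟨R, hR, H⟩, HA⟩ := hA
  -- Zipping `s` and `t` gives the segment of the coded pair when the lengths agree, which the r.e.
  -- set below demands.
  let z : List ℕ → List ℕ → List ℕ := fun s t => (List.range s.length).map fun i =>
    Nat.pair (s.getD i 0) (t.getD i 0)
  have hz : Primrec₂ z := by
    refine Primrec.list_map (Primrec.list_range.comp (Primrec.list_length.comp Primrec.fst)) ?_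
    exact Primrec₂.natPair.comp
      ((Primrec.list_getD 0).comp (Primrec.fst.comp Primrec.fst) Primrec.snd)
      ((Primrec.list_getD 0).comp (Primrec.snd.comp Primrec.fst) Primrec.snd)
  have hzz : ∀ x y : Baire, ∀ n, z (initSeg x n) (initSeg y n) = initSeg (code (x, y)) n := by
    intro x y n
    simp only [z, length_initSeg]
    conv_rhs => rw [initSeg]
    refine List.map_congr_left fun i hi => ?_
    have hi := List.mem_range.1 hi
    simp only [List.getD_eq_getElem?_getD, getElem?_initSeg _ hi]
    rfl
  refine ⟨{p | Q (p.2.1, p.2.2)}, ⟨fun p => p.2.1.length = p.2.2.length ∧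
    ¬ R (z p.2.1 p.2.2), ?_, fun a x y => ?_⟩, fun a x => HA x⟩
  · refine (PrimrecPred.and ?_ (PrimrecPred.not ?_)).computablePred.to_re
    · exact Primrec.eq.comp (Primrec.list_length.comp (Primrec.fst.comp Primrec.snd))
        (Primrec.list_length.comp (Primrec.snd.comp Primrec.snd))
    · exact hR.comp (hz.comp (Primrec.fst.comp Primrec.snd) (Primrec.snd.comp Primrec.snd))
  · have h1 : (a, x, y) ∈ {p : Unit × Baire × Baire | Q (p.2.1, p.2.2)}ᶜ ↔
        ∃ n, ¬ R (initSeg (code (x, y)) n) := by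
      rw [Set.mem_compl_iff, Set.mem_ofPred_eq, H]
      push Not
      rfl
    rw [h1]
    constructor
    · rintro ⟨n, hn⟩
      exact ⟨initSeg x n, initSeg y n, ⟨by simp, by rwa [hzz]⟩, by simp [nbhd], by simp [nbhd]⟩
    · rintro ⟨s, t, ⟨hst, hR⟩, hs, ht⟩
      refine ⟨s.length, ?_⟩
      rw [← hzz]
      rw [nbhd, Set.mem_ofPred_eq] at hs ht
      rwa [hs, hst, ht]

theorem Del.isDelta11Set {A : Set Baire} (hA : Del (· ∈ A)) : IsDelta11Set A :=
  ⟨Sig.isSigma11Set hA.1, Sig.isSigma11Set (A := Aᶜ) hA.2⟩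

/-! ### Comparison of tree ranks by simulations. -/

section Simulation

variable {A B C : Type*} {r : A → A → Prop} {r' : B → B → Prop} {r'' : C → C → Prop}

/-- The node `s` is simulated by the node `t`, where `r` and `r'` relate nodes to their
children. -/
def Sim (r : A → A → Prop) (r' : B → B → Prop) (s : A) (t : B) : Prop :=
  ∃ Z : A → B → Prop, Z s t ∧ ∀ s t, Z s t → ∀ s', r s s' → ∃ t', r' t t' ∧ Z s' t'

namespace Sim

theorem step {s s' : A} {t : B} (h : Sim r r' s t) (hs : r s s') :
    ∃ t', r' t t' ∧ Sim r r' s' t' := by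
  obtain ⟨Z, hst, hZ⟩ := h
  obtain ⟨t', ht, h⟩ := hZ s t hst s' hs
  exact ⟨t', ht, Z, h, hZ⟩

theorem refl (s : A) : Sim r r s s :=
  ⟨Eq, rfl, by rintro s _ rfl s' hs; exact ⟨s', hs, rfl⟩⟩

theorem trans {s : A} {t : B} {u : C} (h : Sim r r' s t) (h' : Sim r' r'' t u) :
    Sim r r'' s u := by
  refine ⟨fun s u => ∃ t, Sim r r' s t ∧ Sim r' r'' t u, ⟨t, h, h'⟩, ?_⟩
  rintro s u ⟨t, h, h'⟩ s' hs
  obtain ⟨t', ht, h⟩ := h.step hs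
  obtain ⟨u', hu, h'⟩ := h'.step ht
  exact ⟨u', hu, t', h, h'⟩

theorem acc {t : B} (ht : Acc (flip r') t) : ∀ {s : A}, Sim r r' s t → Acc (flip r) s := by
  induction ht with
  | intro t _ ih =>
    intro s h
    refine ⟨s, fun s' hs => ?_⟩
    obtain ⟨t', ht', h'⟩ := h.step hs
    exact ih t' ht' h'

/-- In terms of ranks, a child of a well-founded node has strictly smaller rank; otherwise
simulating repeatedly would give an infinite descent. -/
theorem not_child {s : A} (hs : Acc (flip r) s) : ∀ s', r s s' → ¬ Sim r r s s' := by
  induction hs with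
  | intro s _ ih =>
    intro s' hs' h
    obtain ⟨s'', hs'', h'⟩ := h.step hs'
    exact ih s' hs' s'' hs'' h'

theorem exists_child_of_not {s : A} {t : B} (h : ¬ Sim r r' s t) :
    ∃ s', r s s' ∧ ∀ t', r' t t' → ¬ Sim r r' s' t' := by
  by_contra! hcon
  refine h ⟨fun a b => Sim r r' a b ∨ (a = s ∧ b = t), Or.inr ⟨rfl, rfl⟩, ?_⟩
  rintro a b (hab | ⟨rfl, rfl⟩) a' ha
  · obtain ⟨b', hb, h'⟩ := hab.step ha
    exact ⟨b', hb, Or.inl h'⟩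
  · obtain ⟨b', hb, h'⟩ := hcon a' ha
    exact ⟨b', hb, Or.inl h'⟩

/-- Linearity of ranks: if rank s ≤ rank t fails then rank t < rank s, and some child of `s` still
has rank at least that of `t`. The relation "no child of `t` simulates `s`" is itself a simulation
in the other direction. -/
theorem total {s : A} {t : B} (h : ¬ Sim r r' s t) : ∃ s', r s s' ∧ Sim r' r t s' := by
  obtain ⟨s', hs, h'⟩ := exists_child_of_not h
  refine ⟨s', hs, fun t s => ∀ t', r' t t' → ¬ Sim r r' s t', h', fun t s hts t' ht => ?_⟩
  exact exists_child_of_not (hts t' ht)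

/-- An ill-founded node has rank ∞: it always has an ill-founded child with which to answer. -/
theorem of_not_acc {t : B} (ht : ¬ Acc (flip r') t) (s : A) : Sim r r' s t := by
  refine ⟨fun _ t => ¬ Acc (flip r') t, ht, fun s t h s' _ => ?_⟩
  by_contra! hcon
  exact h ⟨t, hcon⟩

end Sim

variable (T : ℕ → A → A → Prop) (o : A)

/-- The index `a` selects the first tree of least rank in the family `T`. -/
def IsLeast (a : ℕ) : Prop :=
  ∀ b, (a ≤ b → Sim (T a) (T b) o o) ∧ (b < a → ∃ t, T b o t ∧ Sim (T a) (T b) o t)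

variable {T o}

/-- This replaces well-ordering of ordinals: if the tree `a`, bounded by the node `t`, is not
minimal, a tree of smaller rank is bounded by a child of `t`. -/
theorem exists_minimal_of_acc {c : ℕ} {t : A} (ht : Acc (flip (T c)) t) :
    ∀ {a : ℕ}, Sim (T a) (T c) o t → ∃ a, ∀ b, Sim (T a) (T b) o o := by
  induction ht with
  | intro t _ ih =>
    intro a ha
    by_contra! hcon
    obtain ⟨b, hb⟩ := hcon a
    obtain ⟨s, hs, hbs⟩ := Sim.total hb
    obtain ⟨t', ht', hst⟩ := ha.step hs
    obtain ⟨a', ha'⟩ := ih t' ht' (hbs.trans hst)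
    obtain ⟨b', hb'⟩ := hcon a'
    exact hb' (ha' b')

/-- If some tree is well founded, take the first index of minimal rank; earlier indices have
strictly larger rank by `Sim.total`. If none is, all ranks are ∞ and index 0 qualifies. -/
theorem exists_isLeast : ∃ a, IsLeast T o a := by
  classical
  by_cases h : ∃ c, Acc (flip (T c)) o
  · obtain ⟨c, hc⟩ := h
    have hmin := exists_minimal_of_acc hc (Sim.refl (r := T c) o)
    refine ⟨Nat.find hmin, fun b => ⟨fun _ => Nat.find_spec hmin b, fun hb => ?_⟩⟩
    have := Nat.find_min hmin hb
    push Not at this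
    obtain ⟨b', hb'⟩ := this
    obtain ⟨t, ht, h⟩ := Sim.total hb'
    exact ⟨t, ht, (Nat.find_spec hmin b').trans h⟩
  · push Not at h
    exact ⟨0, fun b => ⟨fun _ => Sim.of_not_acc (h b) o, fun hb => absurd hb (Nat.not_lt_zero b)⟩⟩

theorem IsLeast.acc {a c : ℕ} (ha : IsLeast T o a) (hc : Acc (flip (T c)) o) :
    Acc (flip (T a)) o := by
  rcases le_or_gt a c with h | h
  · exact Sim.acc hc ((ha c).1 h)
  · obtain ⟨t, ht, h'⟩ := (ha c).2 h
    exact Sim.acc (hc.inv ht) h'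

theorem IsLeast.unique {a b c : ℕ} (ha : IsLeast T o a) (hb : IsLeast T o b)
    (hc : Acc (flip (T c)) o) : a = b := by
  have key : ∀ {a b}, IsLeast T o a → IsLeast T o b → ¬ a < b := by
    intro a b ha hb h
    obtain ⟨t, ht, h'⟩ := (hb a).2 h
    exact Sim.not_child (ha.acc hc) t ht (((ha b).1 h.le).trans h')
  exact le_antisymm (not_lt.1 (key hb ha)) (not_lt.1 (key ha hb))

end Simulation

/-! ### Trees attached to Π¹₁ predicates. -/

/-- The real extending a finite sequence by zeros. -/
def listReal (l : List ℕ) : Baire := fun i => l.getD i 0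

@[fun_prop]
theorem CompMap.listReal {f : Γ → List ℕ} (hf : CompMap f) :
    CompMap fun γ => EffDST.listReal (f γ) := by
  refine CompMap.comp (f := EffDST.listReal) ⟨fun s => (List.range s.length).map fun i =>
    (Denumerable.ofNat (List ℕ) s.headI).getD i 0, ?_, fun l =>
      ⟨fun n => n, tendsto_id, fun n => ?_⟩⟩ hf
  · exact Primrec.list_map (Primrec.list_range.comp Primrec.list_length)
      ((Primrec.list_getD 0).comp ((Primrec.ofNat (List ℕ)).comp
        (Primrec.list_headI.comp Primrec.fst)) Primrec.snd)
  · rcases eq_or_ne n 0 with rfl | hn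
    · rfl
    · have h : (EffDST.initSeg (Ctx.code l) n).headI = Encodable.encode l := headI_initSeg _ hn
      simp only [length_initSeg, h, Denumerable.ofNat_encode]
      rfl

theorem initSeg_listReal_initSeg (y : Baire) (n : ℕ) :
    initSeg (listReal (initSeg y n)) n = initSeg y n :=
  initSeg_congr fun i hi => by
    rw [listReal, List.getD_eq_getElem?_getD, getElem?_initSeg _ hi]; rfl

/-- The finite sequence `l`, paired with the code of `γ`. -/
def node (γ : Γ) (l : List ℕ) : List ℕ := initSeg (code (γ, listReal l)) l.length

@[fun_prop]
theorem CompMap.node {f : Γ → Δ} {g : Γ → List ℕ} (hf : CompMap f) (hg : CompMap g) :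
    CompMap fun γ => EffDST.node (f γ) (g γ) := by
  unfold EffDST.node
  fun_prop

theorem node_initSeg (γ : Γ) (y : Baire) (n : ℕ) :
    node γ (initSeg y n) = initSeg (code (γ, y)) n := by
  rw [node, length_initSeg]
  refine initSeg_congr fun i hi => ?_
  have := initSeg_eq_iff.1 (initSeg_listReal_initSeg y n) i hi
  change Nat.pair _ (listReal (initSeg y n) i) = Nat.pair _ (y i)
  rw [this]

/-- The children of a node of the tree of `γ`. -/
def TreeChild (R : List ℕ → Prop) (γ : Γ) (s t : List ℕ) : Prop :=
  ∃ i, t = s ++ [i] ∧ R (node γ t)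

theorem acc_treeChild_iff {R : List ℕ → Prop} (hR : ∀ s j, R s → R (s.take j)) (γ : Γ) :
    Acc (flip (TreeChild R γ)) [] ↔ ¬ ∃ y : Baire, ∀ n, R (initSeg (code (γ, y)) n) := by
  constructor
  · rintro h ⟨y, hy⟩
    suffices H : ∀ s, Acc (flip (TreeChild R γ)) s → ∀ n, s ≠ initSeg y n from
      H [] h 0 rfl
    intro s hs
    induction hs with
    | intro s _ ih =>
      rintro n rfl
      refine ih (initSeg y (n + 1)) ⟨y n, initSeg_succ y n, ?_⟩ (n + 1) rfl
      rw [node_initSeg]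
      exact hy _
  · intro h
    by_contra hacc
    have hstep : ∀ s : {s // ¬ Acc (flip (TreeChild R γ)) s},
        ∃ t : {s // ¬ Acc (flip (TreeChild R γ)) s}, TreeChild R γ s.1 t.1 := by
      rintro ⟨s, hs⟩
      by_contra! hcon
      exact hs ⟨s, fun t ht => by_contra fun h' => hcon ⟨t, h'⟩ ht⟩
    choose F hF using hstep
    let f : ℕ → {s // ¬ Acc (flip (TreeChild R γ)) s} := fun n => F^[n] ⟨[], hacc⟩
    have hf : ∀ n, TreeChild R γ (f n).1 (f (n + 1)).1 := fun n => by
      simp only [f, Function.iterate_succ_apply']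
      exact hF _
    choose y hy hyR using hf
    have hseg : ∀ n, (f n).1 = initSeg y n := by
      intro n
      induction n with
      | zero => rfl
      | succ n ih => rw [hy, ih, initSeg_succ]
    -- Being a child tests `R` only at nonempty nodes, so length `n` is obtained from length `n +
    -- 1`.
    refine h ⟨y, fun n => Pi.closed_of_frequently hR n.le_succ ?_⟩
    rw [← node_initSeg, ← hseg]
    exact hyR n

/-- Simulations between trees, coded by reals. -/
def TreeSim (R : List ℕ → Prop) (p : ((Γ × ℕ) × ℕ) × List ℕ) : Prop :=
  ∃ z : Baire, ev z (Nat.pair (encode ([] : List ℕ)) (encode p.2)) = 0 ∧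
    ∀ s t : List ℕ, ∀ i, ev z (Nat.pair (encode s) (encode t)) = 0 →
      R (node p.1.1 (s ++ [i])) → ∃ j, R (node (p.1.1.1, p.1.2) (t ++ [j])) ∧
        ev z (Nat.pair (encode (s ++ [i])) (encode (t ++ [j]))) = 0

/-- A simulation is a relation between finite sequences, so a real codes it (value 0 meaning
"related") and the conditions on that real are arithmetical. -/
theorem sig_treeSim {R : List ℕ → Prop} (hR : PrimrecPred R) :
    Sig (TreeSim (Γ := Γ) R) := by
  refine Sig.ex_real (Sig.and (Del.eq (by fun_prop) (by fun_prop)).1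
    (Sig.all_list (Sig.all_list (Sig.all (Del.imp (Del.eq (by fun_prop) (by fun_prop))
      (Del.imp (Del.prim hR (by fun_prop)) (Del.ex (Del.and (Del.prim hR (by fun_prop))
        (Del.eq (by fun_prop) (by fun_prop)))))).1))))

theorem treeSim_iff {R : List ℕ → Prop} {γ : Γ} {a b : ℕ} {t : List ℕ} :
    TreeSim R (((γ, a), b), t) ↔ Sim (TreeChild R (γ, a)) (TreeChild R (γ, b)) [] t := by
  constructor
  · rintro ⟨z, h0, hz⟩
    refine ⟨fun s t => z (Nat.pair (encode s) (encode t)) = 0, h0, ?_⟩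
    rintro s t hst _ ⟨i, rfl, hi⟩
    obtain ⟨j, hj, h⟩ := hz s t i hst hi
    exact ⟨_, ⟨j, rfl, hj⟩, h⟩
  · rintro ⟨Z, h0, hZ⟩
    classical
    let z : Baire := fun k => if Z (Denumerable.ofNat (List ℕ) (Nat.unpair k).1)
      (Denumerable.ofNat (List ℕ) (Nat.unpair k).2) then 0 else 1
    have hz : ∀ s t : List ℕ, ev z (Nat.pair (encode s) (encode t)) = 0 ↔ Z s t := by
      intro s t
      simp [ev, z]
    refine ⟨z, (hz _ _).2 h0, fun s t i hst hi => ?_⟩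
    obtain ⟨_, ⟨j, rfl, hj⟩, h⟩ := hZ s t ((hz _ _).1 hst) _ ⟨i, rfl, hi⟩
    exact ⟨j, hj, (hz _ _).2 h⟩

/-! ### Π¹₁ selection and its two applications. -/

/-- Selection for `Π¹₁` predicates: every such `V` has a `Σ¹₁` selector `U` that is everywhere
nonempty and that picks a unique element of `V` wherever there is one. -/
theorem exists_selector {V : Γ × ℕ → Prop} (hV : Sig fun p => ¬ V p) :
    ∃ U : Γ × ℕ → Prop, Sig U ∧ (∀ γ, ∃ a, U (γ, a)) ∧
      ∀ γ c, V (γ, c) → (∀ a, U (γ, a) → V (γ, a)) ∧ ∀ a b, U (γ, a) → U (γ, b) → a = b := by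
  obtain ⟨Q, hQ, HV⟩ := hV
  obtain ⟨R, hR, hcl, HQ⟩ := hQ.exists_closed
  have hacc : ∀ γ a, Acc (flip (TreeChild R (γ, a))) [] ↔ V (γ, a) := by
    intro γ a
    rw [acc_treeChild_iff hcl, ← not_iff_not, not_not]
    have : ¬ V (γ, a) ↔ _ := HV (γ, a)
    rw [this]
    simp only [HQ]
  refine ⟨fun p => IsLeast (fun a => TreeChild R (p.1, a)) [] p.2, ?_, fun γ => exists_isLeast,
    fun γ c hc => ⟨fun a ha => (hacc γ a).1 (ha.acc ((hacc γ c).2 hc)),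
      fun a b ha hb => ha.unique hb ((hacc γ c).2 hc)⟩⟩
  refine Sig.of_iff (P := fun p : Γ × ℕ => ∀ b, (p.2 < b + 1 → TreeSim R ((p, b), [])) ∧
    (b < p.2 → ∃ j, R (node (p.1, b) [j]) ∧ TreeSim R ((p, b), [j]))) ?_ ?_
  · have hnil : CompMap fun p : (Γ × ℕ) × ℕ => (p, ([] : List ℕ)) := by fun_prop
    have hsing : CompMap fun p : ((Γ × ℕ) × ℕ) × ℕ => [p.2] :=
      CompMap.concat (f := fun _ => []) (CompMap.const _) CompMap.snd
    refine Sig.all (Sig.and ?_ ?_)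
    · refine Sig.of_iff (Sig.or (Del.lt (f := fun p : (Γ × ℕ) × ℕ => p.1.2)
        (g := fun p => p.2 + 1) (by fun_prop) (by fun_prop)).2 ((sig_treeSim hR).comp hnil))
        fun p => imp_iff_not_or
    · refine Sig.of_iff (Sig.or (Del.lt (f := fun p : (Γ × ℕ) × ℕ => p.2)
        (g := fun p => p.1.2) (by fun_prop) (by fun_prop)).2 (Sig.ex
          (P := fun p j => R (node (p.1.1, p.2) [j]) ∧ TreeSim R (p, [j])) (Sig.and ?_ ?_)))
        fun p => imp_iff_not_or
      · exact Sig.prim hR (CompMap.node (f := fun p : ((Γ × ℕ) × ℕ) × ℕ => (p.1.1.1, p.1.2))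
          (by fun_prop) hsing)
      · exact (sig_treeSim hR).comp (f := fun p : ((Γ × ℕ) × ℕ) × ℕ => (p.1, [p.2]))
          (CompMap.pair CompMap.fst hsing)
  · rintro ⟨γ, a⟩
    refine forall_congr' fun b => and_congr ?_ (imp_congr_right fun _ => ?_)
    · rw [treeSim_iff, Nat.lt_succ_iff]
    · simp only [treeSim_iff]
      constructor
      · rintro ⟨_, ⟨j, rfl, hj⟩, h⟩
        exact ⟨j, hj, h⟩
      · rintro ⟨j, hj, h⟩
        exact ⟨[j], ⟨j, rfl, hj⟩, h⟩

/-- Effective Suslin separation. -/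
theorem exists_del_separating {S C : Set Baire} (hS : Sig (· ∈ S)) (hC : Sig (· ∈ C))
    (hSC : Disjoint C S) : ∃ B : Set Baire, Del (· ∈ B) ∧ C ⊆ B ∧ Disjoint B S := by
  -- Label 0 certifies `x ∉ S` and label 1 certifies `x ∉ C`. Disjointness makes a label available
  -- at every `x`, so the Σ¹₁ selector is the graph of a total two-valued function and its fibres
  -- are Δ¹₁.
  have hV : Sig fun p : Baire × ℕ => ¬ ((p.2 = 0 ∧ p.1 ∉ S) ∨ (p.2 = 1 ∧ p.1 ∉ C)) := by
    refine Sig.of_iff (P := fun p : Baire × ℕ => (¬ p.2 = 0 ∨ p.1 ∈ S) ∧ (¬ p.2 = 1 ∨ p.1 ∈ C))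
      (((Del.eq (by fun_prop) (by fun_prop)).2.or (hS.comp CompMap.fst)).and
        ((Del.eq (by fun_prop) (by fun_prop)).2.or (hC.comp CompMap.fst))) fun p => ?_
    tauto
  obtain ⟨U, hU, hne, hsel⟩ := exists_selector (V := fun p : Baire × ℕ =>
    (p.2 = 0 ∧ p.1 ∉ S) ∨ (p.2 = 1 ∧ p.1 ∉ C)) hV
  have hsome : ∀ x, ∃ c, (c = 0 ∧ x ∉ S) ∨ (c = 1 ∧ x ∉ C) := by
    intro x
    by_cases hx : x ∈ S
    · exact ⟨1, Or.inr ⟨rfl, fun h => Set.disjoint_left.1 hSC h hx⟩⟩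
    · exact ⟨0, Or.inl ⟨rfl, hx⟩⟩
  have hcompl : ∀ x, ¬ U (x, 0) ↔ U (x, 1) := by
    intro x
    obtain ⟨c, hc⟩ := hsome x
    obtain ⟨h1, h2⟩ := hsel x c hc
    constructor
    · intro h
      obtain ⟨a, ha⟩ := hne x
      rcases h1 a ha with ⟨h', _⟩ | ⟨h', _⟩
      · exact absurd (h' ▸ ha) h
      · exact h' ▸ ha
    · intro h h'
      exact absurd (h2 _ _ h h') one_ne_zero
  refine ⟨{x | U (x, 0)}, ⟨?_, ?_⟩, fun x hx => ?_, Set.disjoint_left.2 fun x hx hxS => ?_⟩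
  · exact hU.comp (f := fun x : Baire => (x, 0)) (by fun_prop)
  · exact (hU.comp (f := fun x : Baire => (x, 1)) (by fun_prop)).of_iff hcompl
  · by_contra h
    have h := (hcompl x).1 h
    obtain ⟨c, hc⟩ := hsome x
    rcases (hsel x c hc).1 1 h with ⟨h', _⟩ | ⟨_, h'⟩
    · exact one_ne_zero h'
    · exact h' hx
  · obtain ⟨c, hc⟩ := hsome x
    rcases (hsel x c hc).1 0 hx with ⟨_, h'⟩ | ⟨h', _⟩
    · exact h' hxS
    · exact zero_ne_one h'

/-- If above every real there is a real outside the `Σ¹₁` set `S` that is hyperarithmetic in it,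
then such reals can be found in a single `Σ¹₁` set. -/
theorem exists_sig_cofinal {S : Set Baire} (hS : Sig (· ∈ S))
    (h : ∀ d, ¬ hypTuringCone d ⊆ S) :
    ∃ C : Set Baire, Sig (· ∈ C) ∧ Disjoint C S ∧ TuringCofinal C := by
  have hV : Sig fun p : ((ℕ × ℕ) × Baire) × ℕ =>
      ¬ ¬ SigmaEnum ((p.1.1.1, Nat.pair p.1.1.2 p.2), p.1.2) :=
    (sig_sigmaEnum.comp (f := fun p : ((ℕ × ℕ) × Baire) × ℕ =>
      ((p.1.1.1, Nat.pair p.1.1.2 p.2), p.1.2)) (by fun_prop)).of_iff fun _ => not_not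
  obtain ⟨U, hU, hne, hsel⟩ := exists_selector (V := fun p : ((ℕ × ℕ) × Baire) × ℕ =>
    ¬ SigmaEnum ((p.1.1.1, Nat.pair p.1.1.2 p.2), p.1.2)) hV
  -- `M e d` is the set of reals decoded from index `e` with parameter `d`: never empty, and a
  -- singleton when `e` defines the graph of a real.
  let M : ℕ → Baire → Baire → Prop := fun e d x => ∀ n, U (((e, n), d), ev x n)
  have hM : Sig fun p : (ℕ × Baire) × Baire => M p.1.1 p.1.2 p.2 := by
    refine Sig.all ?_
    exact hU.comp (f := fun p : ((ℕ × Baire) × Baire) × ℕ =>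
      (((p.1.1.1, p.2), p.1.1.2), ev p.1.2 p.2)) (by fun_prop)
  have hMne : ∀ e d, ∃ x, M e d x := by
    intro e d
    choose x hx using fun n => hne ((e, n), d)
    exact ⟨x, hx⟩
  have hMeq : ∀ e d x, (∀ n m, x n = m ↔ ¬ SigmaEnum ((e, Nat.pair n m), d)) →
      ∀ y, M e d y → y = x := by
    intro e d x hx y hy
    funext n
    have := (hsel ((e, n), d) (x n) ((hx n _).1 rfl)).1 _ (hy n)
    exact ((hx n _).2 this).symm
  -- Quantifying universally over the decoded reals makes "`e` yields a counterexample above `d`"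
  -- Π¹₁, so a second selection can choose `e` from `d`.
  have hV' : Sig fun p : Baire × ℕ =>
      ¬ ∀ x, M p.2 p.1 x → x ∉ S ∧ TuringLE p.1 x := by
    refine Sig.of_iff (P := fun p : Baire × ℕ => ∃ x, M p.2 p.1 x ∧ (x ∈ S ∨ ¬ TuringLE p.1 x))
      (Sig.ex_real (Sig.and ?_ (Sig.or (hS.comp CompMap.snd) ?_))) fun p => ?_
    · exact hM.comp (f := fun p : (Baire × ℕ) × Baire => ((p.1.2, p.1.1), p.2)) (by fun_prop)
    · exact (del_turingLE.comp (f := fun p : (Baire × ℕ) × Baire => (p.1.1, p.2))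
        (by fun_prop)).2
    · push Not
      refine exists_congr fun x => and_congr_right fun _ => ?_
      tauto
  obtain ⟨N, hN, hNne, hNsel⟩ := exists_selector (V := fun p : Baire × ℕ =>
    ∀ x, M p.2 p.1 x → x ∉ S ∧ TuringLE p.1 x) hV'
  have hex : ∀ d, ∃ e, ∀ x, M e d x → x ∉ S ∧ TuringLE d x := by
    intro d
    obtain ⟨x, ⟨hdx, hxd⟩, hxS⟩ := Set.not_subset.1 (h d)
    obtain ⟨e, he⟩ := hxd.exists_index
    refine ⟨e, fun y hy => ?_⟩
    rw [hMeq e d x he y hy]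
    exact ⟨hxS, hdx⟩
  have hNV : ∀ d e, N (d, e) → ∀ x, M e d x → x ∉ S ∧ TuringLE d x := by
    intro d e hde
    obtain ⟨c, hc⟩ := hex d
    exact (hNsel d c hc).1 e hde
  -- The parameter `d` is quantified away at no cost to Σ¹₁, and letting it range over all reals
  -- makes the set cofinal.
  refine ⟨{x | ∃ d e, N (d, e) ∧ M e d x}, ?_, ?_, fun d => ?_⟩
  · refine Sig.ex_real (P := fun x d => ∃ e, N (d, e) ∧ M e d x) (Sig.ex (Γ := Baire × Baire)
      (P := fun p e => N (p.2, e) ∧ M e p.2 p.1) (Sig.and ?_ ?_))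
    · exact hN.comp (f := fun p : (Baire × Baire) × ℕ => (p.1.2, p.2)) (by fun_prop)
    · exact hM.comp (f := fun p : (Baire × Baire) × ℕ => ((p.2, p.1.2), p.1.1)) (by fun_prop)
  · rw [Set.disjoint_left]
    rintro x ⟨d, e, hde, hx⟩
    exact (hNV d e hde x hx).1
  · obtain ⟨e, he⟩ := hNne d
    obtain ⟨x, hx⟩ := hMne e d
    exact ⟨x, ⟨d, e, he, hx⟩, (hNV d e he x hx).2⟩

end EffDST

/-! ### The determinacy argument. -/

theorem mainTheorem7 (hdet : EffDST.TuringDet EffDST.IsDelta11Set) :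
    EffDST.HypTuringDet EffDST.IsSigma11Set := by
  open EffDST in
  intro S hS hcl hcof
  by_contra! hcon
  obtain ⟨C, hC, hCS, hCcof⟩ := exists_sig_cofinal hS.sig hcon
  obtain ⟨B, hB, hCB, hBS⟩ := exists_del_separating hS.sig hC hCS
  rcases hdet _ (del_turingSat hB).isDelta11Set (turingClosed_turingSat B) with
    ⟨σ, hσ⟩ | ⟨τ, hτ⟩
  · obtain ⟨y, hyS, hy⟩ := hcof (strategyReal σ)
    obtain ⟨x, hxy, hx⟩ := exists_play hy (c := 0) (by norm_num)
    obtain ⟨z, hzB, hxz⟩ := hσ x fun n => hx (2 * n) n rfl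
    -- The play has the degree of `y ∈ S` and also of some `z ∈ B`; Turing closure of `S` moves `z`
    -- into `S`.
    exact Set.disjoint_left.1 hBS hzB (hcl y z (hxy.symm.trans hxz) hyS)
  · obtain ⟨y, hyC, hy⟩ := hCcof (strategyReal τ)
    obtain ⟨x, hxy, hx⟩ := exists_play hy (c := 1) (by norm_num)
    exact hτ x (fun n => hx (2 * n + 1) (n + 1) (by ring)) ⟨y, hCB hyC, hxy⟩
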